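/- **LC³ regret, finite-dimensional bounded features.** Setting. Let $\mathcal X=\mathbb R^{d_{\mathcal X}}$, let $\mathcal U$ be a measurable space, $H\in\mathbb N$, $x_0\in\mathcal X$, $\sigma>0$, and let $\phi:\mathcal X\times\mathcal U\to\mathbb R^{d_\phi}$ be a (known, measurable) feature map with $\|\phi(x,u)\|_2\le B$ for all $(x,u)$. For a matrix $W\in\mathbb R^{d_{\mathcal X}\times d_\phi}$, the dynamics of $W$ are $x_{h+1}=W\phi(x_h,u_h)+\epsilon_h$ for $0\le h<H$, started at $x_0$, with independent $\epsilon_h\sim\mathcal N(0,\sigma^2I)$. The true parameter is some $W^\star\ne0$, with spectral norm $\|W^\star\|_2$. A policy is a (measurable) map $\pi:\mathcal X\times\{0,\dots,H-1\}\to\mathcal U$, $u_h=\pi(x_h,h)$; $\Pi$ is a set of policies. For a cost $c:\mathcal X\times\mathcal U\to[0,\infty)$ let $J^\pi(x_0;c,W)\in[0,\infty]$ be the expectation of $\sum_{h<H}c(x_h,u_h)$ under $\pi$ and $W$, and $J^\star(x_0;c)=\inf_{\pi\in\Pi}J^\pi(x_0;c,W^\star)$. Let $c^0,c^1,\dots$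 be a sequence of non-negative measurable costs such that, for all $t$ and all $\pi\in\Pi$, the expectation of $\big(\sum_{h<H}c^t(x_h,u_h)\big)^2$ under $\pi$ and $W^\star$ is at most $V_{\max}$. Algorithm LC³ with parameters $\lambda>0$ and $C_1$. In episode $t=0,1,2,\dots$ the policy $\pi^t$ is chosen (by a measurable rule) from the trajectories of the previous episodes so that $$\pi^t\in\operatorname*{argmin}_{\pi\in\Pi}\ \inf_{W\in\mathrm{Ball}^t}J^\pi(x_0;c^t,W),$$ existence of such a choice (a computational oracle) being assumed; then $\pi^t$ is executed in the dynamics of $W^\star$ and the trajectory $(x^t_h,u^t_h)$ is observed, the noise being independent over all times and episodes. Here $\mathrm{Ball}^0$ is any set containing $W^\star$ and, for $t\ge1$, $$\mathrm{Ball}^t=\Big\{W:\ \big\|(W-\overline W^t)(\Sigma^t)^{1/2}\big\|_2^2\le\beta^t\Big\},\qquad \Sigma^t=\lambda I+\sum_{\tau<t}\sum_{h<H}\phi(x^\tau_h,u^\tau_h)\phi(x^\tau_h,u^\tau_h)^\top,\quad \Sigma^0=\lambda I,$$ $$\overline W^t=\operatorname*{argmin}_W\ \sum_{\tau<t}\sum_{h<H}\|W\phi(x^\tau_h,u^\tau_h)-x^\tau_{h+1}\|_2^2+\lambda\|W\|_F^2,$$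 $$\beta^t=C_1\Big(\lambda\|W^\star\|_2^2+\sigma^2\big(d_{\mathcal X}+\log(t\det\Sigma^t/\det\Sigma^0)\big)\Big).$$ Result. There exist absolute constants $0<C_1,C_2\le20$ such that in every such setting, if LC³ is run with $\lambda=\sigma^2/\|W^\star\|_2^2$ and $C_1$, then for all $T\in\mathbb N$ the regret $$\mathrm{Regret}_T=\sum_{t<T}\sum_{h<H}c^t(x^t_h,u^t_h)-\sum_{t<T}J^\star(x_0;c^t)$$ is integrable and $$\mathbb E[\mathrm{Regret}_T]\le C_2\sqrt{d_\phi\big(d_\phi+d_{\mathcal X}+\log T+H\big)V_{\max}HT}\cdot\max\Big\{1,\ \log\Big(1+\frac{B^2\|W^\star\|_2^2}{\sigma^2}\,\frac{TH}{d_\phi}\Big)\Big\}$$ (with the convention $\log0=0$ for $T=0$). In particular the bound holds with the factor $\log\big(1+\frac{B^2\|W^\star\|_2^2}{\sigma^2}\frac{TH}{d_\phi}\big)$ alone as soon as that factor is at least $1$. -/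

import Mathlib

open MeasureTheory ProbabilityTheory
open scoped NNReal ENNReal

noncomputable section

namespace LC3

/-- Euclidean space `ℝⁿ` with its `ℓ²` norm. -/
abbrev Vec (n : ℕ) := EuclideanSpace ℝ (Fin n)

/-- Model parameters: linear maps `ℝ^dφ → ℝ^dX`, as matrices. -/
abbrev Param (dX dφ : ℕ) := Matrix (Fin dX) (Fin dφ) ℝ

/-- A controller `π : 𝒳 × {0, …, H-1} → 𝒰`, time argument first. -/
abbrev Policy (dX H : ℕ) (U : Type*) := Fin H → Vec dX → U

/-- The observed trajectory of one episode: states `x_0, …, x_H` and controls `u_0, …, u_{H-1}`. -/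
abbrev Traj (dX H : ℕ) (U : Type*) := (Fin (H + 1) → Vec dX) × (Fin H → U)

/-- The history before episode `t`: the trajectories of the episodes `0, …, t-1`. -/
abbrev History (dX H : ℕ) (U : Type*) (t : ℕ) := Fin t → Traj dX H U

/-- A learning algorithm: a map from the history before episode `t` to the policy `π^t`. -/
abbrev Algorithm (dX H : ℕ) (U : Type*) := (t : ℕ) → History dX H U t → Policy dX H U

/-- The noise law `𝒩(0, σ² I)` on `ℝ^dX`. -/
def gaussianNoise (dX : ℕ) (σ : ℝ) : Measure (Vec dX) :=
  multivariateGaussian 0 (σ ^ 2 • (1 : Matrix (Fin dX) (Fin dX) ℝ))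

/-- The spectral norm `‖M‖₂`. -/
def specNorm {m n : ℕ} (M : Matrix (Fin m) (Fin n) ℝ) : ℝ :=
  ‖LinearMap.toContinuousLinearMap (Matrix.toEuclideanLin M)‖

/-- The squared Frobenius norm `‖M‖_F²`. -/
def frobSq {m n : ℕ} (M : Matrix (Fin m) (Fin n) ℝ) : ℝ := ∑ i, ∑ j, M i j ^ 2

section Dynamics

variable {dX dφ H : ℕ} {U : Type*}

/-- State at time `h` of the system `x_{h+1} = W φ(x_h, u_h) + ε_h`, `u_h = π(x_h, h)`, started at
`x0` and driven by the noise `ε_0, …, ε_{H-1}`. Only the times `h ≤ H` matter. -/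
def state (φ : Vec dX → U → Vec dφ) (W : Param dX dφ) (x0 : Vec dX) (π : Policy dX H U)
    (ε : Fin H → Vec dX) : ℕ → Vec dX
  | 0 => x0
  | h + 1 =>
    if hh : h < H then
      Matrix.toEuclideanLin W
        (φ (state φ W x0 π ε h) (π ⟨h, hh⟩ (state φ W x0 π ε h))) + ε ⟨h, hh⟩
    else state φ W x0 π ε h

/-- The trajectory of `π` in the system with parameter `W`, started at `x0`, with noise `ε`. -/
def rollout (φ : Vec dX → U → Vec dφ) (W : Param dX dφ) (x0 : Vec dX) (π : Policy dX H U)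
    (ε : Fin H → Vec dX) : Traj dX H U :=
  (fun h => state φ W x0 π ε h, fun h => π h (state φ W x0 π ε h))

/-- The realized cumulative cost `∑_{h<H} c(x_h, u_h)` of a trajectory. -/
def cumCost (c : Vec dX → U → ℝ≥0) (τ : Traj dX H U) : ℝ≥0 :=
  ∑ h : Fin H, c (τ.1 h.castSucc) (τ.2 h)

/-- The expected total cost `J^π(x0; c, W)`, in `[0, ∞]`. -/
def J (φ : Vec dX → U → Vec dφ) (σ : ℝ) (x0 : Vec dX) (c : Vec dX → U → ℝ≥0)
    (W : Param dX dφ) (π : Policy dX H U) : ℝ≥0∞ :=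
  ∫⁻ ε, (cumCost c (rollout φ W x0 π ε) : ℝ≥0∞) ∂(Measure.pi fun _ : Fin H => gaussianNoise dX σ)

/-- The second moment of the realized cumulative cost of `π` in the system with parameter `W`. -/
def secondMoment (φ : Vec dX → U → Vec dφ) (σ : ℝ) (x0 : Vec dX) (c : Vec dX → U → ℝ≥0)
    (W : Param dX dφ) (π : Policy dX H U) : ℝ≥0∞ :=
  ∫⁻ ε, (cumCost c (rollout φ W x0 π ε) : ℝ≥0∞) ^ 2
    ∂(Measure.pi fun _ : Fin H => gaussianNoise dX σ)

/-- The best-in-class cost `J^⋆(x0; c) = inf_{π ∈ Π} J^π(x0; c, W)`. -/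
def Jstar (φ : Vec dX → U → Vec dφ) (σ : ℝ) (x0 : Vec dX) (c : Vec dX → U → ℝ≥0)
    (W : Param dX dφ) (Pol : Set (Policy dX H U)) : ℝ≥0∞ :=
  ⨅ π ∈ Pol, J φ σ x0 c W π

end Dynamics

section ConfidenceBall

variable {dX dφ H : ℕ} {U : Type*}

/-- The ridge regression objective
`∑_{τ<t} ∑_{h<H} ‖W φ(x^τ_h, u^τ_h) - x^τ_{h+1}‖² + lam ‖W‖_F²`. -/
def ridgeLoss (φ : Vec dX → U → Vec dφ) (lam : ℝ) {t : ℕ} (hist : History dX H U t)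
    (W : Param dX dφ) : ℝ :=
  (∑ τ : Fin t, ∑ h : Fin H,
    ‖Matrix.toEuclideanLin W (φ ((hist τ).1 h.castSucc) ((hist τ).2 h))
      - (hist τ).1 h.succ‖ ^ 2) + lam * frobSq W

/-- The feature covariance `Σ^t = lam I + ∑_{τ<t} ∑_{h<H} φ(x^τ_h, u^τ_h) φ(x^τ_h, u^τ_h)ᵀ`. -/
def featureCov (φ : Vec dX → U → Vec dφ) (lam : ℝ) {t : ℕ} (hist : History dX H U t) :
    Matrix (Fin dφ) (Fin dφ) ℝ :=
  lam • 1 + ∑ τ : Fin t, ∑ h : Fin H,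
    Matrix.vecMulVec (φ ((hist τ).1 h.castSucc) ((hist τ).2 h)).ofLp
      (φ ((hist τ).1 h.castSucc) ((hist τ).2 h)).ofLp

/-- The squared radius
`β^t = C₁ (lam w² + σ² (dX + log (t det Σ^t / det Σ^0)))`, where `w` is the norm of the true
parameter and `Σ^0 = lam I`. -/
def beta (φ : Vec dX → U → Vec dφ) (C₁ lam σ w : ℝ) {t : ℕ} (hist : History dX H U t) : ℝ :=
  C₁ * (lam * w ^ 2 + σ ^ 2 * ((dX : ℝ) +
    Real.log (t * (featureCov φ lam hist).det /
      (lam • (1 : Matrix (Fin dφ) (Fin dφ) ℝ)).det)))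

open scoped MatrixOrder in
/-- The confidence ball `BALL^t`: at `t = 0` the given initial set, and for `t ≥ 1` the set
of all `W` with `‖(W - W̄^t) (Σ^t)^{1/2}‖₂² ≤ β^t`, where `W̄^t` is the ridge regression solution
(for `lam > 0` it exists and is unique). -/
def ball (φ : Vec dX → U → Vec dφ) (C₁ lam σ w : ℝ) (Ball₀ : Set (Param dX dφ)) {t : ℕ}
    (hist : History dX H U t) : Set (Param dX dφ) :=
  if t = 0 then Ball₀
  else {W | ∃ Wbar : Param dX dφ, (∀ W', ridgeLoss φ lam hist Wbar ≤ ridgeLoss φ lam hist W') ∧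
    specNorm ((W - Wbar) * CFC.sqrt (featureCov φ lam hist)) ^ 2
      ≤ beta φ C₁ lam σ w hist}

end ConfidenceBall

section Interaction

variable {dX dφ H : ℕ} {U : Type*}

/-- The policy `π` is an optimistic choice: `π ∈ argmin_{π ∈ Π} inf_{W ∈ B} J^π(x0; c, W)`. -/
def IsOptimistic (φ : Vec dX → U → Vec dφ) (σ : ℝ) (x0 : Vec dX) (c : Vec dX → U → ℝ≥0)
    (Pol : Set (Policy dX H U)) (B : Set (Param dX dφ)) (π : Policy dX H U) : Prop :=
  π ∈ Pol ∧ ∀ π' ∈ Pol, (⨅ W ∈ B, J φ σ x0 c W π) ≤ (⨅ W ∈ B, J φ σ x0 c W π')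

/-- The trajectory of episode `t` when `alg` interacts with the system with parameter `W` and the
noise in episode `t` at time `h` is `ε t h`. -/
def runTraj (φ : Vec dX → U → Vec dφ) (W : Param dX dφ) (x0 : Vec dX) (alg : Algorithm dX H U)
    (ε : ℕ → Fin H → Vec dX) (t : ℕ) : Traj dX H U :=
  rollout φ W x0 (alg t fun i : Fin t => runTraj φ W x0 alg ε i) (ε t)
termination_by t
decreasing_by exact i.isLt

/-- The history before episode `t` of this interaction. -/
def runHist (φ : Vec dX → U → Vec dφ) (W : Param dX dφ) (x0 : Vec dX) (alg : Algorithm dX H U)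
    (ε : ℕ → Fin H → Vec dX) (t : ℕ) : History dX H U t :=
  fun i => runTraj φ W x0 alg ε i

/-- The regret over `T` episodes with costs `c^0, c^1, …`. -/
def regret (φ : Vec dX → U → Vec dφ) (σ : ℝ) (W : Param dX dφ) (x0 : Vec dX)
    (c : ℕ → Vec dX → U → ℝ≥0) (Pol : Set (Policy dX H U)) (alg : Algorithm dX H U)
    (ε : ℕ → Fin H → Vec dX) (T : ℕ) : ℝ :=
  ∑ t ∈ Finset.range T, (cumCost (c t) (runTraj φ W x0 alg ε t) : ℝ)
    - ∑ t ∈ Finset.range T, (Jstar φ σ x0 (c t) W Pol).toReal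

end Interaction

end LC3

end

/-! The proof is optimism, a change of measure and an elliptical potential. If `W⋆` lies in the ball
of episode `t`, the optimistic value is at most `J⋆`, so the expected excess cost of the episode is
at most `J^π(W⋆) - inf_W J^π(W)` over the ball.

A trajectory of `W⋆` with noise `ε` is also a trajectory of `W` with noise `ε + δ`, where `δ_h = (W⋆
- W) φ_h` depends only on the noise before time `h`. The translation formula for Gaussian measures,
applied one coordinate at a time, then gives `J^π(W⋆) ≤ J^π(W) + V/(2a) + a E[min(∑_h ‖δ_h‖²/σ²,
1)]` for each `a > 0` (`lintegral_le_of_predictable_shift`, `J_le_of_params`). The parameter `a`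
replaces Cauchy–Schwarz: it is common to all episodes and is optimised once, after summation.

Inside the ball `‖δ_h‖² ≤ 4 β^t φ_hᵀ (Σ^t)⁻¹ φ_h`. Adding a whole episode to the covariance
multiplies its determinant by at least `1 + ∑_h φ_hᵀ (Σ^t)⁻¹ φ_h`
(`det_mul_one_add_sum_invQuad_le`), so the truncated widths sum, path by path, to at most a constant
times `(1 + dX + log T + ℓ) ℓ`, where `ℓ = dφ log(1 + ⋯)` bounds the log-determinant ratio
(`sum_width_le`).

That `W⋆` lies in the ball is shown by the method of mixtures. For a unit vector `v`, the ratio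
`det(Σ)^{-1/2} exp(sᵀ Σ⁻¹ s / (2σ²))`, with `s` the sum of the features weighted by the noise in
direction `v`, is a martingale (`lintegral_selfNorm_runHist`). Markov's inequality for its sum over
a `1/2`-net of the sphere of `ℝ^dX` bounds the failure probability in episode `t` by `1/(4t)`.
Failures and episode `0` are paid for by `E[cost] ≤ √V`, a total of at most `√V (1 + √T)`. -/

namespace LC3
open Matrix
open scoped MatrixOrder

/-! ### Determinants and inverse quadratic forms under rank-one updates. -/

section LinearAlgebra

variable {n ι : Type*} [Fintype n]

lemma posSemidef_vecMulVec_self (v : n → ℝ) : (vecMulVec v v).PosSemidef := by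
  simpa using posSemidef_vecMulVec_self_star v

variable [DecidableEq n]

/-- The quadratic form `vᵀ S⁻¹ v`. -/
noncomputable def invQuad (S : Matrix n n ℝ) (v : n → ℝ) : ℝ := v ⬝ᵥ S⁻¹ *ᵥ v

lemma invQuad_nonneg {S : Matrix n n ℝ} (hS : S.PosDef) (v : n → ℝ) : 0 ≤ invQuad S v := by
  simpa [invQuad] using hS.inv.posSemidef.dotProduct_mulVec_nonneg v

lemma det_add_vecMulVec_self {S : Matrix n n ℝ} (hS : S.PosDef) (v : n → ℝ) :
    (S + vecMulVec v v).det = S.det * (1 + invQuad S v) := by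
  have h := det_add_replicateCol_mul_replicateRow (ι := Unit)
    (A := S) ((isUnit_iff_isUnit_det _).1 hS.isUnit) v v
  rw [← vecMulVec_eq] at h
  rw [h, det_unique (n := Unit)]
  simp [invQuad, Matrix.mul_assoc, Matrix.mul_apply, dotProduct, mulVec]

lemma dotProduct_inv_comm {S : Matrix n n ℝ} (hS : S.PosDef) (v w : n → ℝ) :
    v ⬝ᵥ S⁻¹ *ᵥ w = w ⬝ᵥ S⁻¹ *ᵥ v := by
  have h : (S⁻¹)ᵀ = S⁻¹ := by simpa [IsHermitian] using hS.inv.isHermitian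
  rw [dotProduct_mulVec, ← mulVec_transpose, h, dotProduct_comm]

/-- Sherman–Morrison for an appended regression datum with feature `v` and response `y`. Written as
a quadratic in `y`, it is ready for completing the square in `lintegral_selfNorm_gaussianReal`. -/
lemma invQuad_add_vecMulVec_self {S : Matrix n n ℝ} (hS : S.PosDef) (v s : n → ℝ) (y : ℝ) :
    invQuad (S + vecMulVec v v) (s + y • v) =
      invQuad S s + (2 * (v ⬝ᵥ S⁻¹ *ᵥ s) * y + invQuad S v * y ^ 2 - (v ⬝ᵥ S⁻¹ *ᵥ s) ^ 2) /
        (1 + invQuad S v) := by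
  have hp := invQuad_nonneg hS v
  have hp1 : 1 + invQuad S v ≠ 0 := by positivity
  have hS' : (S + vecMulVec v v).PosDef := hS.add_posSemidef (posSemidef_vecMulVec_self v)
  have hu : IsUnit S.det := (isUnit_iff_isUnit_det _).1 hS.isUnit
  have hu' : IsUnit (S + vecMulVec v v).det := (isUnit_iff_isUnit_det _).1 hS'.isUnit
  set p := invQuad S v with hpdef
  set m := v ⬝ᵥ S⁻¹ *ᵥ s with hm
  -- The vector `(S + v vᵀ)⁻¹ (s + y v)` is guessed and checked by multiplying back: the old
  -- solution is corrected along `S⁻¹ v` by the prediction error `y - m` over `1 + p`.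
  have hz : (S + vecMulVec v v) *ᵥ (S⁻¹ *ᵥ s + ((y - m) / (1 + p)) • S⁻¹ *ᵥ v) = s + y • v := by
    rw [add_mulVec, mulVec_add, mulVec_smul, mulVec_mulVec, mulVec_mulVec, mul_nonsing_inv _ hu,
      one_mulVec, one_mulVec, vecMulVec_mulVec, dotProduct_add, dotProduct_smul, ← hm,
      show v ⬝ᵥ S⁻¹ *ᵥ v = p from rfl, smul_eq_mul]
    ext i
    simp only [Pi.add_apply, Pi.smul_apply, smul_eq_mul, MulOpposite.smul_eq_mul_unop,
      MulOpposite.unop_op]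
    field_simp
    ring
  have hinv : (S + vecMulVec v v)⁻¹ *ᵥ (s + y • v) =
      S⁻¹ *ᵥ s + ((y - m) / (1 + p)) • S⁻¹ *ᵥ v := by
    rw [← hz, mulVec_mulVec, nonsing_inv_mul _ hu', one_mulVec]
  rw [invQuad, hinv]
  simp only [add_dotProduct, dotProduct_add, smul_dotProduct, dotProduct_smul, smul_eq_mul]
  rw [dotProduct_inv_comm hS s v, ← hm, show v ⬝ᵥ S⁻¹ *ᵥ v = p from rfl,
    show s ⬝ᵥ S⁻¹ *ᵥ s = invQuad S s from rfl]
  field_simp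
  ring

lemma one_add_sum_le_prod (s : Finset ι) (f : ι → ℝ) (hf : ∀ i ∈ s, 1 ≤ f i) :
    1 + ∑ i ∈ s, (f i - 1) ≤ ∏ i ∈ s, f i ∧ 1 ≤ ∏ i ∈ s, f i := by
  classical
  induction s using Finset.induction_on with
  | empty => simp
  | insert a s ha ih =>
    rw [Finset.sum_insert ha, Finset.prod_insert ha]
    obtain ⟨h1, h2⟩ := ih fun i hi => hf i (Finset.mem_insert_of_mem hi)
    have h3 := hf a (Finset.mem_insert_self a s)
    constructor <;> nlinarith

lemma one_le_eigenvalues {A : Matrix n n ℝ} (hA : A.PosSemidef) (h1 : (1 + A).IsHermitian) (i : n) :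
    1 ≤ h1.eigenvalues i := by
  rw [h1.eigenvalues_eq]
  have hn : star (h1.eigenvectorBasis i).ofLp ⬝ᵥ (h1.eigenvectorBasis i).ofLp = 1 := by
    have h := h1.eigenvectorBasis.orthonormal.1 i
    have h2 := EuclideanSpace.real_norm_sq_eq (h1.eigenvectorBasis i)
    rw [h] at h2
    simp only [dotProduct, star_trivial]
    simp_rw [← sq]
    simpa using h2.symm
  have h0 := hA.dotProduct_mulVec_nonneg (h1.eigenvectorBasis i).ofLp
  rw [add_mulVec, one_mulVec, dotProduct_add, hn]
  simpa using h0

/-- All eigenvalues of `1 + A` are at least `1`, and a product of numbers `1 + aᵢ` with `aᵢ ≥ 0`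
dominates `1 + ∑ aᵢ`. -/
lemma one_add_trace_le_det {A : Matrix n n ℝ} (hA : A.PosSemidef) : 1 + A.trace ≤ (1 + A).det := by
  have h1 : (1 + A).IsHermitian := isHermitian_one.add hA.isHermitian
  have ht := h1.trace_eq_sum_eigenvalues
  rw [trace_add, trace_one] at ht
  have := (one_add_sum_le_prod Finset.univ _ fun i _ => one_le_eigenvalues hA h1 i).1
  rw [h1.det_eq_prod_eigenvalues]
  simp only [Finset.sum_sub_distrib, Finset.sum_const, Finset.card_univ, nsmul_eq_mul, mul_one,
    RCLike.ofReal_real_eq_id, id] at *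
  linarith

/-- The inequality of arithmetic and geometric means for the eigenvalues of `1 + A`. -/
lemma det_one_add_le {A : Matrix n n ℝ} (hA : A.PosSemidef) :
    (1 + A).det ≤ (1 + A.trace / Fintype.card n) ^ Fintype.card n := by
  have h1 : (1 + A).IsHermitian := isHermitian_one.add hA.isHermitian
  rcases isEmpty_or_nonempty n with h | h
  · simp
  have ht := h1.trace_eq_sum_eigenvalues
  rw [trace_add, trace_one] at ht
  have hc : (0 : ℝ) < Fintype.card n := by exact_mod_cast Fintype.card_pos
  have hge : ∀ i, 0 ≤ h1.eigenvalues i := fun i => zero_le_one.trans (one_le_eigenvalues hA h1 i)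
  have hpr := Finset.prod_nonneg (s := Finset.univ) fun i _ => hge i
  have h2 := Real.geom_mean_le_arith_mean Finset.univ (fun _ => 1) h1.eigenvalues (by simp)
    (by simpa using hc) fun i _ => hge i
  simp only [Real.rpow_one, one_mul, Finset.sum_const, Finset.card_univ, nsmul_eq_mul,
    mul_one] at h2
  simp only [RCLike.ofReal_real_eq_id, id] at ht
  rw [← ht, add_div, div_self hc.ne'] at h2
  rw [h1.det_eq_prod_eigenvalues]
  calc _ = ((∏ i, h1.eigenvalues i) ^ ((Fintype.card n : ℝ)⁻¹)) ^ Fintype.card n := by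
        rw [Real.rpow_inv_natCast_pow hpr Fintype.card_ne_zero]; rfl
    _ ≤ _ := pow_le_pow_left₀ (Real.rpow_nonneg hpr _) h2 _

/-- Treats all features of an episode as one update, measured in the covariance frozen at the start
of the episode. The potential argument thereby loses no factor `H`. -/
lemma det_mul_one_add_sum_invQuad_le [Fintype ι] {S : Matrix n n ℝ} (hS : S.PosDef) (v : ι → n → ℝ) :
    S.det * (1 + ∑ i, invQuad S (v i)) ≤ (S + ∑ i, vecMulVec (v i) (v i)).det := by
  set D := ∑ i, vecMulVec (v i) (v i) with hD
  have hDp : D.PosSemidef := posSemidef_sum _ fun i _ => posSemidef_vecMulVec_self (v i)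
  have hu : IsUnit S.det := (isUnit_iff_isUnit_det _).1 hS.isUnit
  -- With `S⁻¹ = R⋆ R`, the matrix `1 + S⁻¹ D` has the determinant of `1 + R D R⋆`, whose second
  -- term is positive semidefinite with trace `∑ vᵢᵀ S⁻¹ vᵢ`.
  obtain ⟨R, hR⟩ := CStarAlgebra.nonneg_iff_eq_star_mul_self.1 hS.inv.posSemidef.nonneg
  have h1 : S + D = S * (1 + star R * (R * D)) := by
    rw [← Matrix.mul_assoc, ← hR, mul_add, mul_one, ← Matrix.mul_assoc, mul_nonsing_inv _ hu,
      one_mul]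
  have h2 : (R * D * star R).PosSemidef := hDp.mul_mul_conjTranspose_same R
  have h3 : (R * D * star R).trace = ∑ i, invQuad S (v i) := by
    rw [trace_mul_comm, ← Matrix.mul_assoc, ← hR, hD, Finset.mul_sum, trace_sum]
    refine Finset.sum_congr rfl fun i _ => ?_
    rw [mul_vecMulVec, trace_vecMulVec, invQuad, dotProduct_comm]
  rw [h1, det_mul, det_one_add_mul_comm]
  refine mul_le_mul_of_nonneg_left ?_ hS.det_pos.le
  rw [← h3]
  exact one_add_trace_le_det h2

end LinearAlgebra
end LC3

namespace LC3

/-! ### Predictable translations of product noise. -/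

section Predictable

variable {E α : Type*} {H : ℕ}

/-- A process indexed by `Fin H` is predictable if its value at time `k` depends only on the noise
at times before `k`. -/
def Predictable (f : Fin H → (Fin H → E) → α) : Prop :=
  ∀ k j, k ≤ j → ∀ ε e, f k (Function.update ε j e) = f k ε

lemma filter_val_lt_succ {k : ℕ} (hk : k < H) :
    (Finset.univ.filter fun i : Fin H => i.val < k + 1) =
      insert ⟨k, hk⟩ (Finset.univ.filter fun i : Fin H => i.val < k) := by
  ext i
  simp only [Finset.mem_filter, Finset.mem_univ, true_and, Finset.mem_insert, Fin.ext_iff]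
  omega

lemma sum_val_lt_succ {M : Type*} [AddCommMonoid M] {k : ℕ} (hk : k < H) (f : Fin H → M) :
    ∑ i with i.val < k + 1, f i = ∑ i with i.val < k, f i + f ⟨k, hk⟩ := by
  rw [filter_val_lt_succ hk, Finset.sum_insert (by simp), add_comm]

lemma prod_val_lt_succ {M : Type*} [CommMonoid M] {k : ℕ} (hk : k < H) (f : Fin H → M) :
    ∏ i with i.val < k + 1, f i = (∏ i with i.val < k, f i) * f ⟨k, hk⟩ := by
  rw [filter_val_lt_succ hk, Finset.prod_insert (by simp), mul_comm]

lemma Predictable.update_of_lt {f : Fin H → (Fin H → E) → α} (hf : Predictable f) {k : ℕ}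
    (hk : k < H) {i : Fin H} (hi : i.val < k) (ε : Fin H → E) (e : E) :
    f i (Function.update ε ⟨k, hk⟩ e) = f i ε := hf i _ hi.le ε e

lemma update_of_val_lt {k : ℕ} (hk : k < H) {i : Fin H} (hi : i.val < k) (ε : Fin H → E) (e : E) :
    Function.update ε ⟨k, hk⟩ e i = ε i :=
  Function.update_of_ne (Fin.ne_of_val_ne hi.ne) _ _

variable [MeasurableSpace E] {ν : Measure E} [IsProbabilityMeasure ν]

/-- Resampling one coordinate preserves the product law. This is how the inductions below integrate
out the newest noise with the others frozen. -/
lemma lintegral_pi_update {F : (Fin H → E) → ℝ≥0∞} (hF : Measurable F) (k : Fin H) :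
    ∫⁻ ε, F ε ∂Measure.pi (fun _ => ν) =
      ∫⁻ ε, ∫⁻ e, F (Function.update ε k e) ∂ν ∂Measure.pi (fun _ => ν) := by
  have hG : Measurable fun ε => ∫⁻ e, F (Function.update ε k e) ∂ν :=
    Measurable.lintegral_prod_right' (f := fun p : (Fin H → E) × E => F (Function.update p.1 k p.2))
      (hF.comp (by fun_prop))
  rcases isEmpty_or_nonempty (Fin H → E) with h | ⟨⟨x⟩⟩
  · simp [Measure.eq_zero_of_isEmpty]
  rw [lintegral_eq_lmarginal_univ x, lintegral_eq_lmarginal_univ x,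
    lmarginal_erase' F hF (Finset.mem_univ k), lmarginal_erase' _ hG (Finset.mem_univ k)]
  simp

/-- Change of variables for a predictable shift of the noise. -/
lemma lintegral_predictable_shift [Add E] [MeasurableAdd₂ E] {ρ : E → E → ℝ≥0∞}
    (hρ : Measurable (Function.uncurry ρ))
    (hshift : ∀ (d : E) (F : E → ℝ≥0∞), Measurable F →
      ∫⁻ e, F (e + d) * ρ d e ∂ν = ∫⁻ e, F e ∂ν)
    {δ : Fin H → (Fin H → E) → E} (hδ : Predictable δ) (hδm : ∀ k, Measurable (δ k))
    {F : (Fin H → E) → ℝ≥0∞} (hF : Measurable F) :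
    ∫⁻ ε, F (fun i => ε i + δ i ε) * ∏ i, ρ (δ i ε) (ε i) ∂Measure.pi (fun _ => ν) =
      ∫⁻ ε, F ε ∂Measure.pi (fun _ => ν) := by
  have hρm : ∀ i, Measurable fun ε : Fin H → E => ρ (δ i ε) (ε i) := fun i =>
    hρ.comp ((hδm i).prodMk (measurable_pi_apply i))
  -- Only the first `m` coordinates are shifted, and `m` is raised by one at a time.
  have key : ∀ m ≤ H, ∫⁻ ε, F (fun i => if i.val < m then ε i + δ i ε else ε i) *
      ∏ i with i.val < m, ρ (δ i ε) (ε i) ∂Measure.pi (fun _ => ν) =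
      ∫⁻ ε, F ε ∂Measure.pi (fun _ => ν) := by
    intro m
    have hmeas : ∀ m : ℕ, Measurable fun ε : Fin H → E =>
        F (fun i => if i.val < m then ε i + δ i ε else ε i) *
          ∏ i with i.val < m, ρ (δ i ε) (ε i) := by
      intro m
      refine (hF.comp (measurable_pi_lambda _ fun i => ?_)).mul
        (Finset.measurable_prod _ fun i _ => hρm i)
      split_ifs
      · exact (measurable_pi_apply i).add (hδm i)
      · exact measurable_pi_apply i
    induction m with
    | zero => simp
    | succ k ih =>
      intro hk
      have hk' : k < H := hk
      rw [← ih hk'.le, lintegral_pi_update (hmeas (k + 1)) ⟨k, hk'⟩,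
        lintegral_pi_update (hmeas k) ⟨k, hk'⟩]
      refine lintegral_congr fun ε => ?_
      set P := ∏ i with i.val < k, ρ (δ i ε) (ε i) with hP
      have hprod : ∀ e, ∏ i with i.val < k, ρ (δ i (Function.update ε ⟨k, hk'⟩ e))
          (Function.update ε ⟨k, hk'⟩ e i) = P := fun e =>
        Finset.prod_congr rfl fun i hi => by
          have hi' := (Finset.mem_filter.1 hi).2
          rw [hδ.update_of_lt hk' hi', update_of_val_lt hk' hi']
      have hF1 : ∀ e, (fun i : Fin H => if i.val < k then Function.update ε ⟨k, hk'⟩ e i +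
          δ i (Function.update ε ⟨k, hk'⟩ e) else Function.update ε ⟨k, hk'⟩ e i) =
          Function.update (fun i => if i.val < k then ε i + δ i ε else ε i) ⟨k, hk'⟩ e := by
        intro e
        ext1 i
        rcases lt_trichotomy i.val k with h | h | h
        · rw [update_of_val_lt hk' h, update_of_val_lt hk' h, hδ.update_of_lt hk' h]
        · obtain rfl : i = ⟨k, hk'⟩ := Fin.ext h
          simp
        · have hne : i ≠ ⟨k, hk'⟩ := Fin.ne_of_val_ne h.ne'
          simp [Function.update_of_ne hne, h.not_gt]
      have hF2 : ∀ e, (fun i : Fin H => if i.val < k + 1 then Function.update ε ⟨k, hk'⟩ e i +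
          δ i (Function.update ε ⟨k, hk'⟩ e) else Function.update ε ⟨k, hk'⟩ e i) =
          Function.update (fun i => if i.val < k then ε i + δ i ε else ε i) ⟨k, hk'⟩
            (e + δ ⟨k, hk'⟩ ε) := by
        intro e
        ext1 i
        rcases lt_trichotomy i.val k with h | h | h
        · rw [update_of_val_lt hk' h, update_of_val_lt hk' h, hδ.update_of_lt hk' h]
          simp [h, h.trans (Nat.lt_succ_self k)]
        · obtain rfl : i = ⟨k, hk'⟩ := Fin.ext h
          simp [hδ _ _ le_rfl]
        · have hne : i ≠ ⟨k, hk'⟩ := Fin.ne_of_val_ne h.ne'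
          simp [Function.update_of_ne hne, h.not_gt, show ¬ i.val < k + 1 by omega]
      -- By predictability the earlier shifts, their densities and `δ k` are all constant in the
      -- resampled coordinate, so what remains is the one-coordinate translation formula.
      simp_rw [prod_val_lt_succ hk', hprod, hF1, hF2, Function.update_self, hδ _ _ le_rfl]
      have hG : Measurable fun e => F (Function.update
          (fun i : Fin H => if i.val < k then ε i + δ i ε else ε i) ⟨k, hk'⟩ e) * P :=
        (hF.comp (measurable_update _)).mul_const _
      rw [← hshift (δ ⟨k, hk'⟩ ε) _ hG]
      exact lintegral_congr fun e => by ring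
  have := key H le_rfl
  simpa using this

end Predictable

/-! ### Translation and one-dimensional marginals of the Gaussian noise. -/

section Gaussian

open scoped RealInnerProductSpace

/-- Translation of a centered Gaussian measure on `ℝ`. -/
lemma lintegral_gaussianReal_shift {v : ℝ≥0} (hv : v ≠ 0) (d : ℝ) {F : ℝ → ℝ≥0∞}
    (hF : Measurable F) :
    ∫⁻ e, F (e + d) * ENNReal.ofReal (Real.exp (-((d * e + d ^ 2 / 2) / v))) ∂gaussianReal 0 v =
      ∫⁻ e, F e ∂gaussianReal 0 v := by
  rw [gaussianReal_of_var_ne_zero _ hv,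
    lintegral_withDensity_eq_lintegral_mul _ (measurable_gaussianPDF 0 v) (by fun_prop),
    lintegral_withDensity_eq_lintegral_mul _ (measurable_gaussianPDF 0 v) hF]
  conv_rhs => rw [← lintegral_add_right_eq_self _ d]
  refine lintegral_congr fun e => ?_
  have hv' : (v : ℝ) ≠ 0 := by exact_mod_cast hv
  simp only [Pi.mul_apply, gaussianPDF]
  rw [mul_comm (F _), ← mul_assoc, ← ENNReal.ofReal_mul (gaussianPDFReal_nonneg _ _ _)]
  congr 2
  rw [gaussianPDFReal, gaussianPDFReal, mul_assoc, ← Real.exp_add]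
  congr 2
  field_simp
  ring

variable {dX : ℕ} {σ : ℝ}

lemma posSemidef_sq_smul_one : (σ ^ 2 • (1 : Matrix (Fin dX) (Fin dX) ℝ)).PosSemidef :=
  Matrix.PosSemidef.one.smul (sq_nonneg σ)

instance : IsProbabilityMeasure (gaussianNoise dX σ) := by
  unfold gaussianNoise; infer_instance

lemma gaussianNoise_eq_map_pi :
    gaussianNoise dX σ =
      (Measure.pi fun _ : Fin dX => gaussianReal 0 (σ ^ 2).toNNReal).map (WithLp.toLp 2) := by
  apply Measure.ext_of_charFun (E := EuclideanSpace ℝ (Fin dX))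
  ext t
  rw [gaussianNoise, charFun_multivariateGaussian posSemidef_sq_smul_one]
  simp_rw [charFun_pi, charFun_gaussianReal, ← Complex.exp_sum]
  congr 1
  simp [Matrix.smul_mulVec, dotProduct, Real.coe_toNNReal _ (sq_nonneg σ), Finset.sum_div,
    ← Finset.sum_neg_distrib]
  refine Finset.sum_congr rfl fun i _ => ?_
  ring

/-- Translation of the noise law. -/
lemma lintegral_gaussianNoise_shift (hσ : 0 < σ) (d : Vec dX) {F : Vec dX → ℝ≥0∞}
    (hF : Measurable F) :
    ∫⁻ e, F (e + d) * ENNReal.ofReal (Real.exp (-((⟪d, e⟫ + ‖d‖ ^ 2 / 2) / σ ^ 2)))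
      ∂gaussianNoise dX σ = ∫⁻ e, F e ∂gaussianNoise dX σ := by
  have hv : (σ ^ 2).toNNReal ≠ 0 := by simp [hσ.ne']
  have hto : Measurable (WithLp.toLp 2 : (Fin dX → ℝ) → Vec dX) := by fun_prop
  rw [gaussianNoise_eq_map_pi, lintegral_map (by fun_prop) hto, lintegral_map hF hto]
  -- The predictable shift lemma is reused with the `dX` coordinates in the role of time and a
  -- constant shift, which reduces the vector formula to the scalar one.
  have h := lintegral_predictable_shift (ν := gaussianReal 0 (σ ^ 2).toNNReal)
    (ρ := fun d e => ENNReal.ofReal (Real.exp (-((d * e + d ^ 2 / 2) / (σ ^ 2).toNNReal))))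
    (by unfold Function.uncurry; fun_prop)
    (fun d F hF => lintegral_gaussianReal_shift hv d hF) (δ := fun i _ => d i)
    (fun _ _ _ _ _ => rfl) (fun _ => measurable_const) (hF.comp hto)
  refine Eq.trans ?_ h
  refine lintegral_congr fun e => ?_
  rw [← ENNReal.ofReal_prod_of_nonneg (fun _ _ => (Real.exp_pos _).le), ← Real.exp_sum]
  congr 3
  rw [Finset.sum_neg_distrib, ← Finset.sum_div, Finset.sum_add_distrib,
    EuclideanSpace.real_norm_sq_eq, Finset.sum_div]
  simp [PiLp.inner_apply, Real.coe_toNNReal _ (sq_nonneg σ), mul_comm]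

lemma map_inner_gaussianNoise (v : Vec dX) (hv : ‖v‖ = 1) :
    (gaussianNoise dX σ).map (fun e => ⟪v, e⟫) = gaussianReal 0 (σ ^ 2).toNNReal := by
  apply Measure.ext_of_charFun
  ext t
  have h : charFun ((gaussianNoise dX σ).map (fun e => ⟪v, e⟫)) t =
      charFun (gaussianNoise dX σ) (t • v) := by
    rw [charFun_apply, charFun_apply, integral_map (by fun_prop) (by fun_prop)]
    refine integral_congr_ae (ae_of_all _ fun e => ?_)
    simp [inner_smul_right, real_inner_comm, mul_comm]
  have hn : ∑ i, v i * v i = 1 := by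
    have := EuclideanSpace.real_norm_sq_eq v
    rw [hv] at this
    simpa [sq] using this.symm
  have hn' : (∑ i, (v i : ℂ) * v i) = 1 := by exact_mod_cast hn
  rw [h, gaussianNoise, charFun_multivariateGaussian posSemidef_sq_smul_one, charFun_gaussianReal]
  congr 1
  simp [Matrix.smul_mulVec, dotProduct, Real.coe_toNNReal _ (sq_nonneg σ)]
  calc _ = (σ : ℂ) ^ 2 * t ^ 2 * ∑ i, (v i : ℂ) * v i := by
        rw [Finset.mul_sum]
        exact Finset.sum_congr rfl fun i _ => by ring
    _ = _ := by rw [hn', mul_one]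

lemma integral_inner_gaussianNoise (v : Vec dX) :
    Integrable (fun e => ⟪v, e⟫) (gaussianNoise dX σ) ∧ ∫ e, ⟪v, e⟫ ∂gaussianNoise dX σ = 0 := by
  have hi : Integrable (fun e : Vec dX => e) (gaussianNoise dX σ) := by
    unfold gaussianNoise; exact IsGaussian.integrable_fun_id
  refine ⟨hi.const_inner v, ?_⟩
  rw [integral_inner hi]
  simp [gaussianNoise]

end Gaussian
end LC3

namespace LC3

/-! ### The simulation inequality by change of measure. -/

section Simulation

open scoped RealInnerProductSpace

/-- The function `y ↦ e^{-y} - 1 + y`, whose expectation at a log-likelihood ratio is a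
Kullback-Leibler divergence. -/
noncomputable def klGap (y : ℝ) : ℝ := Real.exp (-y) - 1 + y

lemma klGap_nonneg (y : ℝ) : 0 ≤ klGap y := by
  have := Real.add_one_le_exp (-y)
  unfold klGap; linarith

lemma measurable_klGap : Measurable klGap := by unfold klGap; fun_prop

/-- With `s = 1 - e^{-y}` one has `y = -log(1 - s) ≥ s + s²/2`, the first two terms of a series with
nonnegative terms, and `klGap y = y - s`. -/
lemma sq_one_sub_exp_neg_le {y : ℝ} (hy : 0 ≤ y) : (1 - Real.exp (-y)) ^ 2 ≤ 2 * klGap y := by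
  set x := Real.exp (-y) with hx
  have hx0 : 0 < x := Real.exp_pos _
  have hx1 : x ≤ 1 := Real.exp_le_one_iff.2 (by linarith)
  have h1 : 1 - x ≤ y := by have := Real.add_one_le_exp (-y); linarith
  have h2 : |1 - x| < 1 := by rw [abs_lt]; constructor <;> linarith
  have h3 := sum_le_hasSum (Finset.range 2)
    (fun i _ => by have := sub_nonneg.2 hx1; positivity) (Real.hasSum_pow_div_log_of_abs_lt_one h2)
  rw [sub_sub_cancel, hx, Real.log_exp] at h3
  simp only [Finset.sum_range_succ, Finset.sum_range_zero] at h3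
  norm_num at h3
  unfold klGap
  linarith

lemma mul_le_sq_div_add_sq {a : ℝ} (ha : 0 < a) (c s : ℝ) :
    c * s ≤ c ^ 2 / (2 * a) + a / 2 * s ^ 2 := by
  have h1 : c ^ 2 / (2 * a) + a / 2 * s ^ 2 - c * s = (c - a * s) ^ 2 / (2 * a) := by
    field_simp; ring
  have h2 : 0 ≤ (c - a * s) ^ 2 / (2 * a) := by positivity
  linarith

/-- The loss `c (1 - e^{-y})` from changing measure is split by Young's inequality into a second
moment part and a divergence part. For `y < 0` there is no loss. -/
lemma le_mul_exp_neg_add_klGap {a c : ℝ} (ha : 0 < a) (hc : 0 ≤ c) (y : ℝ) :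
    c ≤ c * Real.exp (-y) + c ^ 2 / (2 * a) + a * klGap y := by
  have hk := mul_nonneg ha.le (klGap_nonneg y)
  rcases le_or_gt 0 y with hy | hy
  · have h1 := mul_le_mul_of_nonneg_left (sq_one_sub_exp_neg_le hy) (half_pos ha).le
    have h2 := mul_le_sq_div_add_sq ha c (1 - Real.exp (-y))
    linarith
  · have h1 := mul_le_mul_of_nonneg_left (Real.one_le_exp (neg_pos.2 hy).le) hc
    have h4 : 0 ≤ c ^ 2 / (2 * a) := by positivity
    linarith

variable {dX H : ℕ} {σ : ℝ}

/-- The log-likelihood ratio of the noise `e` against its translate by `d`. -/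
noncomputable def shiftLog (σ : ℝ) (d e : Vec dX) : ℝ := (⟪d, e⟫ + ‖d‖ ^ 2 / 2) / σ ^ 2

lemma Measurable.shiftLog {Ω : Type*} [MeasurableSpace Ω] {f g : Ω → Vec dX} (hf : Measurable f)
    (hg : Measurable g) : Measurable fun x => LC3.shiftLog σ (f x) (g x) := by
  unfold LC3.shiftLog; fun_prop

/-- One step of the chain rule for relative entropy: `e^{-ℓ}` has mean `1` and `ℓ` has mean
`‖d‖²/(2σ²)`, where `ℓ = shiftLog σ d e`, so the exponential part of `klGap` is preserved and only
the linear part grows. -/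
lemma lintegral_klGap_add_shiftLog (hσ : 0 < σ) (d : Vec dX) (y : ℝ) :
    ∫⁻ e, ENNReal.ofReal (klGap (y + shiftLog σ d e)) ∂gaussianNoise dX σ =
      ENNReal.ofReal (klGap y) + ENNReal.ofReal (‖d‖ ^ 2 / (2 * σ ^ 2)) := by
  have hm : Measurable fun e : Vec dX => shiftLog σ d e :=
    Measurable.shiftLog measurable_const measurable_id
  have h1 : ∫⁻ e, ENNReal.ofReal (Real.exp (-shiftLog σ d e)) ∂gaussianNoise dX σ = 1 := by
    have := lintegral_gaussianNoise_shift hσ d (F := fun _ => 1) measurable_const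
    simpa [shiftLog] using this
  have hexp : Integrable (fun e => Real.exp (-shiftLog σ d e)) (gaussianNoise dX σ) := by
    refine ⟨by fun_prop, ?_⟩
    rw [hasFiniteIntegral_iff_ofReal (ae_of_all _ fun _ => (Real.exp_pos _).le), h1]
    simp
  have h1' : ∫ e, Real.exp (-shiftLog σ d e) ∂gaussianNoise dX σ = 1 := by
    rw [integral_eq_lintegral_of_nonneg_ae (ae_of_all _ fun _ => (Real.exp_pos _).le)
      (by fun_prop), h1]
    simp
  obtain ⟨hi, hi0⟩ := integral_inner_gaussianNoise (σ := σ) d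
  have hlog : Integrable (fun e => shiftLog σ d e) (gaussianNoise dX σ) :=
    (hi.add (integrable_const _)).div_const _
  have h2 : ∫ e, shiftLog σ d e ∂gaussianNoise dX σ = ‖d‖ ^ 2 / (2 * σ ^ 2) := by
    unfold shiftLog
    rw [integral_div, integral_add hi (integrable_const _), hi0]
    simp
    field_simp
  have hrw : ∀ e, klGap (y + shiftLog σ d e) =
      Real.exp (-y) * Real.exp (-shiftLog σ d e) + (shiftLog σ d e + (y - 1)) := fun e => by
    rw [klGap, neg_add, Real.exp_add]; ring
  rw [← ENNReal.ofReal_add (klGap_nonneg y) (by positivity),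
    ← ofReal_integral_eq_lintegral_ofReal ?_ (ae_of_all _ fun _ => klGap_nonneg _)]
  · have hlog' : Integrable (fun e => shiftLog σ d e + (y - 1)) (gaussianNoise dX σ) :=
      hlog.add (integrable_const _)
    simp_rw [hrw]
    rw [integral_add (hexp.const_mul _) hlog', integral_const_mul, h1',
      integral_add hlog (integrable_const _), h2]
    simp [klGap]
    ring_nf
  · simp_rw [hrw]
    exact (hexp.const_mul _).add (hlog.add (integrable_const _))

/-- The relative entropy of a predictable shift is half its expected squared size over `σ²`. Both
sides may be infinite, so no integrability is needed. -/
lemma lintegral_klGap_sum_shiftLog (hσ : 0 < σ) {δ : Fin H → (Fin H → Vec dX) → Vec dX}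
    (hδ : Predictable δ) (hδm : ∀ k, Measurable (δ k)) :
    ∫⁻ ε, ENNReal.ofReal (klGap (∑ i, shiftLog σ (δ i ε) (ε i)))
        ∂Measure.pi (fun _ => gaussianNoise dX σ) =
      ∫⁻ ε, ENNReal.ofReal (∑ i, ‖δ i ε‖ ^ 2 / (2 * σ ^ 2))
        ∂Measure.pi (fun _ => gaussianNoise dX σ) := by
  have hlm : ∀ i, Measurable fun ε : Fin H → Vec dX => shiftLog σ (δ i ε) (ε i) := fun i =>
    Measurable.shiftLog (hδm i) (measurable_pi_apply i)
  have key : ∀ m ≤ H, ∫⁻ ε, ENNReal.ofReal (klGap (∑ i with i.val < m, shiftLog σ (δ i ε) (ε i)))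
        ∂Measure.pi (fun _ => gaussianNoise dX σ) =
      ∫⁻ ε, ENNReal.ofReal (∑ i with i.val < m, ‖δ i ε‖ ^ 2 / (2 * σ ^ 2))
        ∂Measure.pi (fun _ => gaussianNoise dX σ) := by
    intro m
    have hmeas : ∀ m : ℕ, Measurable fun ε : Fin H → Vec dX =>
        ENNReal.ofReal (klGap (∑ i with i.val < m, shiftLog σ (δ i ε) (ε i))) := fun m =>
      (measurable_klGap.comp (Finset.measurable_sum _ fun i _ => hlm i)).ennreal_ofReal
    induction m with
    | zero => simp [klGap]
    | succ k ih =>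
      intro hk
      have hk' : k < H := hk
      have hsum : ∀ ε e, ∑ i with i.val < k, shiftLog σ (δ i (Function.update ε ⟨k, hk'⟩ e))
          (Function.update ε ⟨k, hk'⟩ e i) = ∑ i with i.val < k, shiftLog σ (δ i ε) (ε i) :=
        fun ε e => Finset.sum_congr rfl fun i hi => by
          have hi' := (Finset.mem_filter.1 hi).2
          rw [hδ.update_of_lt hk' hi', update_of_val_lt hk' hi']
      rw [lintegral_pi_update (hmeas (k + 1)) ⟨k, hk'⟩]
      simp_rw [sum_val_lt_succ hk', hsum, Function.update_self, hδ _ _ le_rfl,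
        lintegral_klGap_add_shiftLog hσ]
      rw [lintegral_add_left (hmeas k), ih hk'.le, ← lintegral_add_left]
      · refine lintegral_congr fun ε => ?_
        rw [← ENNReal.ofReal_add (Finset.sum_nonneg fun _ _ => by positivity) (by positivity)]
      · exact (Finset.measurable_sum _ fun i _ =>
          ((hδm i).norm.pow_const 2).div_const _).ennreal_ofReal
  have := key H le_rfl
  simpa using this

/-- The summands of a finite sequence up to the last time the running sum is at most one. -/
noncomputable def truncate (f : Fin H → ℝ) (k : Fin H) : ℝ :=
  if ∑ i with i ≤ k, f i ≤ 1 then f k else 0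

lemma sum_truncate (f : Fin H → ℝ) (hf : ∀ i, 0 ≤ f i) :
    ∑ k, truncate f k ≤ 1 ∧ (∑ k, f k ≤ 1 → ∀ k, truncate f k = f k) := by
  have hle : ∀ k : Fin H, ∑ i with i.val < k.val + 1, f i = ∑ i with i ≤ k, f i := fun k => by
    congr 1; ext i; simp
  have key : ∀ m ≤ H, ∑ k with k.val < m, truncate f k ≤ 1 ∧
      (∑ k with k.val < m, f k ≤ 1 →
        ∑ k with k.val < m, truncate f k = ∑ k with k.val < m, f k) := by
    intro m
    induction m with
    | zero => simp
    | succ k ih =>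
      intro hk
      have hk' : k < H := hk
      obtain ⟨h1, h2⟩ := ih hk'.le
      have h3 := hle ⟨k, hk'⟩
      have h4 := hf ⟨k, hk'⟩
      simp only at h3
      rw [sum_val_lt_succ hk'] at h3 ⊢
      rw [sum_val_lt_succ hk']
      unfold truncate at *
      rw [← h3]
      by_cases h : ∑ i with i.val < k, f i + f ⟨k, hk'⟩ ≤ 1
      · rw [if_pos h, h2 (by linarith)]
        exact ⟨h, fun _ => rfl⟩
      · rw [if_neg h, add_zero]
        exact ⟨h1, fun h' => absurd h' h⟩
  refine ⟨by simpa using (key H le_rfl).1, fun h k => ?_⟩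
  rw [truncate, if_pos]
  exact (Finset.sum_le_univ_sum_of_nonneg hf).trans h

/-- A predictable shift, stopped at the last time its running squared size is at most `σ²`. -/
noncomputable def truncShift (σ : ℝ) (δ : Fin H → (Fin H → Vec dX) → Vec dX) (k : Fin H)
    (ε : Fin H → Vec dX) : Vec dX :=
  if ∑ i with i ≤ k, ‖δ i ε‖ ^ 2 / σ ^ 2 ≤ 1 then δ k ε else 0

section truncShift

variable {δ : Fin H → (Fin H → Vec dX) → Vec dX}

/-- The stopping test at time `k` may include `δ k` itself, which depends only on earlier noise. The
stopped sum therefore never overshoots the threshold. -/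
lemma Predictable.truncShift (hδ : Predictable δ) : Predictable (truncShift σ δ) := by
  intro k j hkj ε e
  have : ∑ i with i ≤ k, ‖δ i (Function.update ε j e)‖ ^ 2 / σ ^ 2 =
      ∑ i with i ≤ k, ‖δ i ε‖ ^ 2 / σ ^ 2 := Finset.sum_congr rfl fun i hi => by
    rw [hδ i j ((Finset.mem_filter.1 hi).2.trans hkj)]
  simp only [LC3.truncShift, this, hδ k j hkj]

lemma measurable_truncShift (hδm : ∀ k, Measurable (δ k)) (k : Fin H) :
    Measurable (truncShift σ δ k) :=
  Measurable.ite (measurableSet_le (Finset.measurable_sum _ fun i _ =>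
    ((hδm i).norm.pow_const 2).div_const _) measurable_const) (hδm k) measurable_const

lemma sum_sq_truncShift_le (δ : Fin H → (Fin H → Vec dX) → Vec dX) (ε : Fin H → Vec dX) :
    ∑ k, ‖truncShift σ δ k ε‖ ^ 2 / σ ^ 2 ≤ 1 := by
  refine le_of_eq_of_le (Finset.sum_congr rfl fun k _ => ?_)
    (sum_truncate (fun i => ‖δ i ε‖ ^ 2 / σ ^ 2) fun i => by positivity).1
  simp only [truncShift, truncate]
  split_ifs <;> simp

lemma truncShift_eq {ε : Fin H → Vec dX} (h : ∑ i, ‖δ i ε‖ ^ 2 / σ ^ 2 ≤ 1) (k : Fin H) :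
    truncShift σ δ k ε = δ k ε :=
  if_pos ((Finset.sum_le_univ_sum_of_nonneg fun i => by positivity).trans h)

/-- Turns the two error terms of `cost_le_truncShift` into one truncated size. If the total size
exceeds `1`, the stopped shift costs at most `1/2` and the indicator another `1/2`; otherwise only
half of the size is used. -/
lemma half_sum_sq_truncShift_add_le (δ : Fin H → (Fin H → Vec dX) → Vec dX)
    (ε : Fin H → Vec dX) :
    ∑ i, ‖truncShift σ δ i ε‖ ^ 2 / (2 * σ ^ 2) +
      1 / 2 * (if ∑ i, ‖δ i ε‖ ^ 2 / σ ^ 2 ≤ 1 then 0 else 1) ≤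
      min (∑ i, ‖δ i ε‖ ^ 2 / σ ^ 2) 1 := by
  have h2 : ∑ i, ‖truncShift σ δ i ε‖ ^ 2 / (2 * σ ^ 2) =
      1 / 2 * ∑ i, ‖truncShift σ δ i ε‖ ^ 2 / σ ^ 2 := by
    rw [Finset.mul_sum]
    exact Finset.sum_congr rfl fun i _ => by field_simp
  have h3 := sum_sq_truncShift_le (σ := σ) δ ε
  by_cases h1 : ∑ i, ‖δ i ε‖ ^ 2 / σ ^ 2 ≤ 1
  · have h0 : 0 ≤ ∑ i, ‖δ i ε‖ ^ 2 / σ ^ 2 := Finset.sum_nonneg fun _ _ => by positivity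
    rw [h2, Finset.sum_congr rfl fun i _ => by rw [truncShift_eq h1 i], if_pos h1, min_eq_left h1]
    linarith
  · rw [h2, if_neg h1, min_eq_right (not_le.1 h1).le]
    linarith

/-- The exponential weight uses the full shift, since only then does the change of measure return
the original integral exactly. The divergence uses the stopped shift, which keeps its expectation
bounded. -/
lemma cost_le_truncShift {a : ℝ} (ha : 0 < a) (δ : Fin H → (Fin H → Vec dX) → Vec dX)
    (ε : Fin H → Vec dX) (c : ℝ≥0) :
    (c : ℝ≥0∞) ≤ c * ENNReal.ofReal (Real.exp (-∑ i, shiftLog σ (δ i ε) (ε i))) +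
      ENNReal.ofReal (1 / (2 * a)) * (c : ℝ≥0∞) ^ 2 + ENNReal.ofReal a *
      (ENNReal.ofReal (klGap (∑ i, shiftLog σ (truncShift σ δ i ε) (ε i))) +
        ENNReal.ofReal (1 / 2 * (if ∑ i, ‖δ i ε‖ ^ 2 / σ ^ 2 ≤ 1 then 0 else 1))) := by
  have hc := c.coe_nonneg
  set y := ∑ i, shiftLog σ (δ i ε) (ε i) with hy
  set y' := ∑ i, shiftLog σ (truncShift σ δ i ε) (ε i) with hy'
  set b : ℝ := if ∑ i, ‖δ i ε‖ ^ 2 / σ ^ 2 ≤ 1 then 0 else 1 with hb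
  have hb0 : 0 ≤ b := by rw [hb]; split_ifs <;> norm_num
  have hk := klGap_nonneg y'
  have key : (c : ℝ) ≤ c * Real.exp (-y) + 1 / (2 * a) * (c : ℝ) ^ 2 +
      a * (klGap y' + 1 / 2 * b) := by
    have hcc : 1 / (2 * a) * (c : ℝ) ^ 2 = (c : ℝ) ^ 2 / (2 * a) := by ring
    rw [hcc]
    by_cases h1 : ∑ i, ‖δ i ε‖ ^ 2 / σ ^ 2 ≤ 1
    · have hyy : y' = y := Finset.sum_congr rfl fun i _ => by rw [truncShift_eq h1 i]
      have h2 := le_mul_exp_neg_add_klGap ha hc y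
      rw [hb, if_pos h1, hyy]
      linarith
    -- When the shift is too large the change of measure is given up: `c ≤ c²/(2a) + a/2`, and the
    -- indicator pays for `a/2`.
    · have h2 := mul_le_sq_div_add_sq ha (c : ℝ) 1
      have h3 := mul_nonneg ha.le hk
      have h4 := mul_nonneg hc (Real.exp_pos (-y)).le
      rw [hb, if_neg h1]
      linarith
  have h := ENNReal.ofReal_le_ofReal key
  rw [ENNReal.ofReal_add (by positivity) (by positivity),
    ENNReal.ofReal_add (by positivity) (by positivity), ENNReal.ofReal_mul hc,
    ENNReal.ofReal_mul (by positivity), ENNReal.ofReal_mul ha.le,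
    ENNReal.ofReal_add hk (by positivity), ENNReal.ofReal_pow hc, ENNReal.ofReal_coe_nnreal] at h
  exact h

end truncShift

lemma lintegral_add_const_mul_add {Ω : Type*} [MeasurableSpace Ω] {μ : Measure Ω}
    {f g h k : Ω → ℝ≥0∞} (hf : Measurable f) (hg : Measurable g) (hh : Measurable h)
    (hk : Measurable k) (c d : ℝ≥0∞) :
    ∫⁻ x, (f x + c * g x + d * (h x + k x)) ∂μ =
      ∫⁻ x, f x ∂μ + c * ∫⁻ x, g x ∂μ + d * (∫⁻ x, h x ∂μ + ∫⁻ x, k x ∂μ) := by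
  have h1 : Measurable fun x => f x + c * g x := hf.add (hg.const_mul c)
  have h2 : Measurable fun x => h x + k x := hh.add hk
  rw [lintegral_add_left h1, lintegral_add_left hf, lintegral_const_mul _ hg,
    lintegral_const_mul _ h2, lintegral_add_left hh]

/-- Change of measure: translating the noise by a predictable process changes the expectation
of a nonnegative cost with second moment at most `V` by at most
`V / (2a) + a E[min (S, 1)]`, where `S` is the total squared size of the shift over `σ²`. -/
lemma lintegral_le_of_predictable_shift (hσ : 0 < σ) {δ : Fin H → (Fin H → Vec dX) → Vec dX}
    (hδ : Predictable δ) (hδm : ∀ k, Measurable (δ k))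
    {F : (Fin H → Vec dX) → ℝ≥0} (hF : Measurable F) {V : ℝ≥0}
    (hV : ∫⁻ ε, (F (fun i => ε i + δ i ε) : ℝ≥0∞) ^ 2 ∂Measure.pi (fun _ => gaussianNoise dX σ) ≤ V)
    {a : ℝ} (ha : 0 < a) :
    ∫⁻ ε, (F (fun i => ε i + δ i ε) : ℝ≥0∞) ∂Measure.pi (fun _ => gaussianNoise dX σ) ≤
      ∫⁻ ε, (F ε : ℝ≥0∞) ∂Measure.pi (fun _ => gaussianNoise dX σ) + ENNReal.ofReal (V / (2 * a)) +
      ENNReal.ofReal a * ∫⁻ ε, ENNReal.ofReal (min (∑ i, ‖δ i ε‖ ^ 2 / σ ^ 2) 1)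
        ∂Measure.pi (fun _ => gaussianNoise dX σ) := by
  set μ := Measure.pi (fun _ : Fin H => gaussianNoise dX σ) with hμ
  set C : (Fin H → Vec dX) → ℝ≥0 := fun ε => F (fun i => ε i + δ i ε) with hC
  have hCm : Measurable C := hF.comp
    (measurable_pi_lambda _ fun i => (measurable_pi_apply i).add (hδm i))
  have hδ'm := measurable_truncShift (σ := σ) hδm
  have hlm : ∀ {δ : Fin H → (Fin H → Vec dX) → Vec dX}, (∀ k, Measurable (δ k)) →
      Measurable fun ε => ∑ i, shiftLog σ (δ i ε) (ε i) := fun hδm =>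
    Finset.measurable_sum _ fun i _ =>
      Measurable.shiftLog (hδm i) (measurable_pi_apply i)
  have hem : Measurable fun ε =>
      (C ε : ℝ≥0∞) * ENNReal.ofReal (Real.exp (-∑ i, shiftLog σ (δ i ε) (ε i))) :=
    hCm.coe_nnreal_ennreal.mul (hlm hδm).neg.exp.ennreal_ofReal
  have hkm : Measurable fun ε =>
      ENNReal.ofReal (klGap (∑ i, shiftLog σ (truncShift σ δ i ε) (ε i))) :=
    (measurable_klGap.comp (hlm hδ'm)).ennreal_ofReal
  have hbm : Measurable fun ε =>
      ENNReal.ofReal (1 / 2 * (if ∑ i, ‖δ i ε‖ ^ 2 / σ ^ 2 ≤ 1 then 0 else 1)) :=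
    Measurable.ennreal_ofReal (Measurable.const_mul (Measurable.ite (measurableSet_le
      (Finset.measurable_sum _ fun i _ => ((hδm i).norm.pow_const 2).div_const _) measurable_const)
      measurable_const measurable_const) _)
  -- The exact change of measure: weighting by `e^{-y}` undoes the full shift.
  have hcov : ∫⁻ ε, C ε * ENNReal.ofReal (Real.exp (-∑ i, shiftLog σ (δ i ε) (ε i))) ∂μ =
      ∫⁻ ε, (F ε : ℝ≥0∞) ∂μ := by
    have h := lintegral_predictable_shift (ν := gaussianNoise dX σ)
      (ρ := fun d e => ENNReal.ofReal (Real.exp (-shiftLog σ d e)))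
      ((Measurable.shiftLog measurable_fst measurable_snd).neg.exp.ennreal_ofReal)
      (fun d F hF => lintegral_gaussianNoise_shift hσ d hF) hδ hδm hF.coe_nnreal_ennreal
    rw [← h]
    refine lintegral_congr fun ε => ?_
    rw [← ENNReal.ofReal_prod_of_nonneg (fun _ _ => (Real.exp_pos _).le), ← Real.exp_sum,
      Finset.sum_neg_distrib]
  calc ∫⁻ ε, (C ε : ℝ≥0∞) ∂μ ≤ _ := lintegral_mono fun ε => cost_le_truncShift (σ := σ) ha δ ε (C ε)
    _ = ∫⁻ ε, (F ε : ℝ≥0∞) ∂μ + ENNReal.ofReal (1 / (2 * a)) * ∫⁻ ε, (C ε : ℝ≥0∞) ^ 2 ∂μ +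
        ENNReal.ofReal a * (∫⁻ ε, ENNReal.ofReal (∑ i, ‖truncShift σ δ i ε‖ ^ 2 / (2 * σ ^ 2)) ∂μ +
          ∫⁻ ε, ENNReal.ofReal (1 / 2 * (if ∑ i, ‖δ i ε‖ ^ 2 / σ ^ 2 ≤ 1 then 0 else 1)) ∂μ) := by
        rw [lintegral_add_const_mul_add hem (hCm.coe_nnreal_ennreal.pow_const 2) hkm hbm, hcov,
          lintegral_klGap_sum_shiftLog hσ hδ.truncShift hδ'm]
    _ ≤ _ := by
        refine add_le_add (add_le_add le_rfl ?_) (mul_le_mul_right ?_ _)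
        · calc _ ≤ ENNReal.ofReal (1 / (2 * a)) * V := mul_le_mul_right hV _
            _ = _ := by
              rw [← ENNReal.ofReal_coe_nnreal, ← ENNReal.ofReal_mul (by positivity)]
              congr 1; ring
        · rw [← lintegral_add_left (Finset.measurable_sum _ fun i _ =>
              ((hδ'm i).norm.pow_const 2).div_const _).ennreal_ofReal]
          refine lintegral_mono fun ε => ?_
          rw [← ENNReal.ofReal_add (Finset.sum_nonneg fun _ _ => by positivity)
            (by split_ifs <;> norm_num)]
          exact ENNReal.ofReal_le_ofReal (half_sum_sq_truncShift_add_le δ ε)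

end Simulation
end LC3

namespace LC3
open Matrix

/-! ### The Gaussian mixture martingale. -/

section SelfNormalized

open scoped RealInnerProductSpace

variable {n : Type*} [Fintype n] [DecidableEq n]

lemma Measurable.matrix_det {Ω : Type*} [MeasurableSpace Ω] {A : Ω → Matrix n n ℝ}
    (hA : ∀ i j, Measurable fun x => A x i j) : Measurable fun x => (A x).det := by
  simp_rw [det_apply]
  exact Finset.measurable_sum _ fun p _ =>
    Measurable.const_smul (Finset.measurable_prod _ fun i _ => hA _ _) _

lemma Measurable.invQuad {Ω : Type*} [MeasurableSpace Ω] {A : Ω → Matrix n n ℝ} {v : Ω → n → ℝ}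
    (hA : ∀ i j, Measurable fun x => A x i j) (hv : ∀ i, Measurable fun x => v x i) :
    Measurable fun x => LC3.invQuad (A x) (v x) := by
  have hadj : ∀ i j, Measurable fun x => (A x).adjugate i j := by
    intro i j
    simp_rw [adjugate_apply]
    refine Measurable.matrix_det fun k l => ?_
    simp_rw [updateRow_apply]
    split_ifs
    · exact measurable_const
    · exact hA k l
  have hinv : ∀ i j, Measurable fun x => (A x)⁻¹ i j := by
    intro i j
    simp_rw [inv_def, Matrix.smul_apply, Ring.inverse_eq_inv', smul_eq_mul]
    exact (Measurable.matrix_det hA).inv.mul (hadj i j)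
  unfold LC3.invQuad dotProduct mulVec dotProduct
  exact Finset.measurable_sum _ fun i _ => (hv i).mul
    (Finset.measurable_sum _ fun j _ => (hinv i j).mul (hv j))

/-- The Gaussian mixture likelihood ratio `det(S)^{-1/2} exp(sᵀ S⁻¹ s / (2σ²))`. -/
noncomputable def selfNorm (σ : ℝ) (S : Matrix n n ℝ) (s : n → ℝ) : ℝ≥0∞ :=
  ENNReal.ofReal (Real.exp (invQuad S s / (2 * σ ^ 2)) / √S.det)

lemma Measurable.selfNorm {Ω : Type*} [MeasurableSpace Ω] {σ : ℝ} {A : Ω → Matrix n n ℝ}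
    {v : Ω → n → ℝ} (hA : ∀ i j, Measurable fun x => A x i j)
    (hv : ∀ i, Measurable fun x => v x i) :
    Measurable fun x => LC3.selfNorm σ (A x) (v x) :=
  (((Measurable.invQuad hA hv).div_const _).exp.div (Measurable.matrix_det hA).sqrt).ennreal_ofReal

/-- The one-step martingale identity. `selfNorm` is, up to a constant factor, a likelihood ratio
averaged over a Gaussian prior, so integrating out a fresh observation returns its previous value.
-/
lemma lintegral_selfNorm_gaussianReal {σ : ℝ} (hσ : 0 < σ) {S : Matrix n n ℝ} (hS : S.PosDef)
    (s v : n → ℝ) :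
    ∫⁻ y, selfNorm σ (S + vecMulVec v v) (s + y • v) ∂gaussianReal 0 (σ ^ 2).toNNReal =
      selfNorm σ S s := by
  have hv : (σ ^ 2).toNNReal ≠ 0 := by simp [hσ.ne']
  have hp := invQuad_nonneg hS v
  have hd := hS.det_pos
  set p := invQuad S v with hpdef
  set m := v ⬝ᵥ S⁻¹ *ᵥ s with hm
  set w : ℝ≥0 := (σ ^ 2 * (1 + p)).toNNReal with hw
  have hw0 : w ≠ 0 := by
    have : 0 < σ ^ 2 * (1 + p) := by positivity
    simpa [hw] using this
  -- Completing the square produces the predictive density of the next response: mean `m = vᵀ S⁻¹ s`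
  -- and variance `σ² (1 + p)`. The factor `√(1 + p)` comes from the determinant update.
  have hpt : ∀ y, gaussianPDF 0 (σ ^ 2).toNNReal y * selfNorm σ (S + vecMulVec v v) (s + y • v) =
      selfNorm σ S s * gaussianPDF m w y := by
    intro y
    unfold gaussianPDF selfNorm
    rw [← ENNReal.ofReal_mul (gaussianPDFReal_nonneg _ _ _), ← ENNReal.ofReal_mul (by positivity)]
    congr 1
    rw [det_add_vecMulVec_self hS, invQuad_add_vecMulVec_self hS, ← hpdef, ← hm]
    simp only [gaussianPDFReal]
    rw [hw, Real.coe_toNNReal _ (sq_nonneg σ), Real.coe_toNNReal _ (by positivity),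
      ← mul_assoc (2 * Real.pi), Real.sqrt_mul hd.le,
      Real.sqrt_mul (x := 2 * Real.pi * σ ^ 2) (by positivity)]
    have hexp : Real.exp (-(y - 0) ^ 2 / (2 * σ ^ 2)) *
        Real.exp ((invQuad S s + (2 * m * y + p * y ^ 2 - m ^ 2) / (1 + p)) / (2 * σ ^ 2)) =
        Real.exp (invQuad S s / (2 * σ ^ 2)) *
          Real.exp (-(y - m) ^ 2 / (2 * (σ ^ 2 * (1 + p)))) := by
      rw [← Real.exp_add, ← Real.exp_add]
      congr 1
      field_simp
      ring
    calc _ = (√(2 * Real.pi * σ ^ 2))⁻¹ * (Real.exp (-(y - 0) ^ 2 / (2 * σ ^ 2)) *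
        Real.exp ((invQuad S s + (2 * m * y + p * y ^ 2 - m ^ 2) / (1 + p)) / (2 * σ ^ 2))) /
          (√S.det * √(1 + p)) := by ring
      _ = _ := by rw [hexp]; field_simp
  have hmeas : Measurable fun y : ℝ => selfNorm σ (S + vecMulVec v v) (s + y • v) :=
    Measurable.selfNorm (fun _ _ => measurable_const) fun i => by
      simp only [Pi.add_apply, Pi.smul_apply]; fun_prop
  rw [gaussianReal_of_var_ne_zero _ hv,
    lintegral_withDensity_eq_lintegral_mul _ (measurable_gaussianPDF _ _) hmeas]
  simp_rw [Pi.mul_apply, hpt]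
  rw [lintegral_const_mul _ (measurable_gaussianPDF _ _), lintegral_gaussianPDF_eq_one _ hw0,
    mul_one]

variable {dX H : ℕ}

lemma posDef_add_sum_vecMulVec {ι m : Type*} [Fintype m] {S : Matrix m m ℝ} (hS : S.PosDef)
    (I : Finset ι) (f : ι → m → ℝ) : (S + ∑ i ∈ I, vecMulVec (f i) (f i)).PosDef :=
  hS.add_posSemidef (posSemidef_sum _ fun i _ => posSemidef_vecMulVec_self (f i))

/-- Peels off the times one by one: given the earlier noise the next feature is fixed, and `⟪v, ε
k⟫` is a scalar Gaussian of variance `σ²` because `v` is a unit vector. -/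
lemma lintegral_selfNorm_predictable {σ : ℝ} (hσ : 0 < σ) {S : Matrix n n ℝ} (hS : S.PosDef)
    (s : n → ℝ) {v : Vec dX} (hv : ‖v‖ = 1) {f : Fin H → (Fin H → Vec dX) → n → ℝ}
    (hf : Predictable f) (hfm : ∀ k, Measurable (f k)) :
    ∫⁻ ε, selfNorm σ (S + ∑ i, vecMulVec (f i ε) (f i ε)) (s + ∑ i, ⟪v, ε i⟫ • f i ε)
      ∂Measure.pi (fun _ => gaussianNoise dX σ) = selfNorm σ S s := by
  have hfm' : ∀ k i, Measurable fun ε => f k ε i := fun k i => (measurable_pi_apply i).comp (hfm k)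
  have key : ∀ m ≤ H, ∫⁻ ε, selfNorm σ (S + ∑ i with i.val < m, vecMulVec (f i ε) (f i ε))
        (s + ∑ i with i.val < m, ⟪v, ε i⟫ • f i ε) ∂Measure.pi (fun _ => gaussianNoise dX σ) =
      selfNorm σ S s := by
    intro m
    have hmeas : ∀ m : ℕ, Measurable fun ε : Fin H → Vec dX =>
        selfNorm σ (S + ∑ i with i.val < m, vecMulVec (f i ε) (f i ε))
          (s + ∑ i with i.val < m, ⟪v, ε i⟫ • f i ε) := by
      intro m
      refine Measurable.selfNorm (fun i j => ?_) fun i => ?_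
      · simp only [Matrix.add_apply, Matrix.sum_apply, vecMulVec_apply]
        exact measurable_const.add (Finset.measurable_sum _ fun k _ => (hfm' k i).mul (hfm' k j))
      · simp only [Pi.add_apply, Finset.sum_apply, Pi.smul_apply, smul_eq_mul]
        exact measurable_const.add (Finset.measurable_sum _ fun k _ =>
          (measurable_const.inner (measurable_pi_apply k)).mul (hfm' k i))
    induction m with
    | zero => simp
    | succ k ih =>
      intro hk
      have hk' : k < H := hk
      have h1 : ∀ ε e, ∑ i with i.val < k, vecMulVec (f i (Function.update ε ⟨k, hk'⟩ e))
          (f i (Function.update ε ⟨k, hk'⟩ e)) =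
          ∑ i with i.val < k, vecMulVec (f i ε) (f i ε) :=
        fun ε e => Finset.sum_congr rfl fun i hi => by
          rw [hf.update_of_lt hk' (Finset.mem_filter.1 hi).2]
      have h2 : ∀ ε e, ∑ i with i.val < k, ⟪v, Function.update ε ⟨k, hk'⟩ e i⟫ •
          f i (Function.update ε ⟨k, hk'⟩ e) = ∑ i with i.val < k, ⟪v, ε i⟫ • f i ε :=
        fun ε e => Finset.sum_congr rfl fun i hi => by
          have hi' := (Finset.mem_filter.1 hi).2
          rw [hf.update_of_lt hk' hi', update_of_val_lt hk' hi']
      rw [← ih hk'.le, lintegral_pi_update (hmeas (k + 1)) ⟨k, hk'⟩]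
      refine lintegral_congr fun ε => ?_
      simp_rw [sum_val_lt_succ hk', h1, h2, Function.update_self, hf _ _ le_rfl, ← add_assoc]
      rw [← lintegral_selfNorm_gaussianReal hσ (posDef_add_sum_vecMulVec hS _ _) _ (f ⟨k, hk'⟩ ε),
        ← map_inner_gaussianNoise v hv, lintegral_map _ (by fun_prop)]
      exact Measurable.selfNorm (fun _ _ => measurable_const) fun i => by
        simp only [Pi.add_apply, Pi.smul_apply]; fun_prop
  have := key H le_rfl
  simpa using this

end SelfNormalized

/-! ### Trajectories as functions of the noise. -/

section Rollout

variable {dX dφ H : ℕ} {U : Type*}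

lemma state_update (φ : Vec dX → U → Vec dφ) (W : Param dX dφ) (x0 : Vec dX)
    (π : Policy dX H U) (ε : Fin H → Vec dX) (j : Fin H) (e : Vec dX) {h : ℕ} (hj : h ≤ j.val) :
    state φ W x0 π (Function.update ε j e) h = state φ W x0 π ε h := by
  induction h with
  | zero => rfl
  | succ h ih =>
    have hh : h < H := by omega
    rw [state, state, dif_pos hh, dif_pos hh, ih (by omega),
      Function.update_of_ne (Fin.ne_of_val_ne (by simp only; omega))]

lemma state_succ (φ : Vec dX → U → Vec dφ) (W : Param dX dφ) (x0 : Vec dX)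
    (π : Policy dX H U) (ε : Fin H → Vec dX) (h : Fin H) :
    state φ W x0 π ε (h.val + 1) = Matrix.toEuclideanLin W
      (φ (state φ W x0 π ε h) (π h (state φ W x0 π ε h))) + ε h := by
  rw [state, dif_pos h.isLt]

/-- The difference of the two drifts is moved into the noise, so comparing parameters becomes
comparing noise laws. -/
lemma state_shift (φ : Vec dX → U → Vec dφ) (W W' : Param dX dφ) (x0 : Vec dX)
    (π : Policy dX H U) (ε : Fin H → Vec dX) (h : ℕ) :
    state φ W' x0 π (fun i => ε i + Matrix.toEuclideanLin (W - W')
      (φ (state φ W x0 π ε i) (π i (state φ W x0 π ε i)))) h = state φ W x0 π ε h := by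
  induction h with
  | zero => rfl
  | succ h ih =>
    rw [state, state, ih]
    split_ifs
    · simp only [map_sub, LinearMap.sub_apply]
      abel
    · rfl

/-- The feature vector observed at time `h` of a trajectory. -/
def feat (φ : Vec dX → U → Vec dφ) (τ : Traj dX H U) (h : Fin H) : Vec dφ :=
  φ (τ.1 h.castSucc) (τ.2 h)

lemma predictable_feat (φ : Vec dX → U → Vec dφ) (W : Param dX dφ) (x0 : Vec dX)
    (π : Policy dX H U) : Predictable fun h ε => feat φ (rollout φ W x0 π ε) h := by
  intro k j hkj ε e
  simp only [feat, rollout, Fin.val_castSucc, state_update φ W x0 π ε j e hkj]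

variable [MeasurableSpace U]

lemma measurable_state {Ω : Type*} [MeasurableSpace Ω] {φ : Vec dX → U → Vec dφ}
    (hφ : Measurable (Function.uncurry φ)) (W : Param dX dφ) (x0 : Vec dX)
    {π : Ω → Policy dX H U} (hπ : ∀ h, Measurable fun p : Ω × Vec dX => π p.1 h p.2)
    {ε : Ω → Fin H → Vec dX} (hε : Measurable ε) (h : ℕ) :
    Measurable fun ω => state φ W x0 (π ω) (ε ω) h := by
  induction h with
  | zero => exact measurable_const
  | succ h ih =>
    simp only [state]
    split_ifs with hh
    · have hu : Measurable fun ω => π ω ⟨h, hh⟩ (state φ W x0 (π ω) (ε ω) h) :=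
        (hπ ⟨h, hh⟩).comp (measurable_id.prodMk ih)
      have hfe : Measurable fun ω => φ (state φ W x0 (π ω) (ε ω) h)
          (π ω ⟨h, hh⟩ (state φ W x0 (π ω) (ε ω) h)) := hφ.comp (ih.prodMk hu)
      refine Measurable.add ?_ ((measurable_pi_apply _).comp hε)
      exact (LinearMap.toContinuousLinearMap (Matrix.toEuclideanLin W)).measurable.comp hfe
    · exact ih

lemma measurable_rollout {Ω : Type*} [MeasurableSpace Ω] {φ : Vec dX → U → Vec dφ}
    (hφ : Measurable (Function.uncurry φ)) (W : Param dX dφ) (x0 : Vec dX)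
    {π : Ω → Policy dX H U} (hπ : ∀ h, Measurable fun p : Ω × Vec dX => π p.1 h p.2)
    {ε : Ω → Fin H → Vec dX} (hε : Measurable ε) :
    Measurable fun ω => rollout φ W x0 (π ω) (ε ω) := by
  refine Measurable.prodMk (measurable_pi_lambda _ fun h => measurable_state hφ W x0 hπ hε h)
    (measurable_pi_lambda _ fun h => ?_)
  exact (hπ h).comp (measurable_id.prodMk (measurable_state hφ W x0 hπ hε h))

lemma measurable_cumCost {c : Vec dX → U → ℝ≥0} (hc : Measurable (Function.uncurry c)) :
    Measurable (cumCost c : Traj dX H U → ℝ≥0) :=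
  Finset.measurable_sum _ fun h _ => hc.comp (f := fun τ : Traj dX H U => (τ.1 h.castSucc, τ.2 h))
    (by fun_prop)

lemma measurable_feat {φ : Vec dX → U → Vec dφ} (hφ : Measurable (Function.uncurry φ))
    (h : Fin H) : Measurable fun τ : Traj dX H U => feat φ τ h :=
  hφ.comp (f := fun τ : Traj dX H U => (τ.1 h.castSucc, τ.2 h)) (by fun_prop)

lemma measurable_feat_rollout {φ : Vec dX → U → Vec dφ} (hφ : Measurable (Function.uncurry φ))
    (W : Param dX dφ) (x0 : Vec dX) {π : Policy dX H U} (hπ : ∀ h, Measurable (π h)) (h : Fin H) :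
    Measurable fun ε => feat φ (rollout φ W x0 π ε) h :=
  (measurable_feat hφ h).comp (measurable_rollout hφ W x0 (π := fun _ => π)
    (fun h => (hπ h).comp measurable_snd) measurable_id)

/-- The simulation inequality. -/
lemma J_le_of_params {φ : Vec dX → U → Vec dφ} (hφ : Measurable (Function.uncurry φ)) {σ : ℝ}
    (hσ : 0 < σ) (x0 : Vec dX) {c : Vec dX → U → ℝ≥0} (hc : Measurable (Function.uncurry c))
    (W W' : Param dX dφ) {π : Policy dX H U} (hπ : ∀ h, Measurable (π h)) {V : ℝ≥0}
    (hV : secondMoment φ σ x0 c W π ≤ V) {a : ℝ} (ha : 0 < a) :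
    J φ σ x0 c W π ≤ J φ σ x0 c W' π + ENNReal.ofReal (V / (2 * a)) + ENNReal.ofReal a *
      ∫⁻ ε, ENNReal.ofReal (min (∑ h, ‖Matrix.toEuclideanLin (W - W')
        (feat φ (rollout φ W x0 π ε) h)‖ ^ 2 / σ ^ 2) 1)
        ∂Measure.pi (fun _ : Fin H => gaussianNoise dX σ) := by
  have hpred := predictable_feat (H := H) φ W x0 π
  have hro : ∀ ε, rollout φ W' x0 π (fun i => ε i + Matrix.toEuclideanLin (W - W')
      (feat φ (rollout φ W x0 π ε) i)) = rollout φ W x0 π ε := by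
    intro ε
    have h := state_shift φ W W' x0 π ε
    simp only [rollout, feat, Fin.val_castSucc, h]
  have h := lintegral_le_of_predictable_shift (V := V) hσ
    (δ := fun i ε => Matrix.toEuclideanLin (W - W') (feat φ (rollout φ W x0 π ε) i))
    (fun k j hkj ε e => by simp only [hpred k j hkj ε e])
    (fun k => (LinearMap.toContinuousLinearMap
      (Matrix.toEuclideanLin (W - W'))).measurable.comp (measurable_feat_rollout hφ W x0 hπ k))
    (F := fun ε => cumCost c (rollout φ W' x0 π ε))
    ((measurable_cumCost hc).comp (measurable_rollout hφ W' x0 (π := fun _ => π)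
      (fun h => (hπ h).comp measurable_snd) measurable_id))
    (by simp only [hro]; exact hV) ha
  simp only [hro] at h
  exact h

end Rollout
end LC3

namespace LC3
open Matrix

/-! ### Nets on the unit sphere. -/

section Net

/-- The unit sphere of `ℝᵈ` has a `1/2`-net with at most `5ᵈ` elements. -/
lemma exists_half_net (d : ℕ) : ∃ N : Finset (Vec d), (∀ v ∈ N, ‖v‖ = 1) ∧ N.card ≤ 5 ^ d ∧
    ∀ u : Vec d, ‖u‖ = 1 → ∃ v ∈ N, ‖u - v‖ ≤ 1 / 2 := by
  classical
  have hcard : ∀ s : Finset (Vec d), (∀ v ∈ s, ‖v‖ = 1) →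
      (∀ v ∈ s, ∀ w ∈ s, v ≠ w → 1 / 2 < ‖v - w‖) → s.card ≤ 5 ^ d := by
    intro s h1 h2
    -- Doubling turns `1/2`-separated unit vectors into `1`-separated vectors of norm at most `2`,
    -- to which `Besicovitch.card_le_of_separated` applies.
    have hinj : Function.Injective fun v : Vec d => (2 : ℝ) • v :=
      smul_right_injective _ two_ne_zero
    have := Besicovitch.card_le_of_separated (s.image fun v => (2 : ℝ) • v)
      (by simp only [Finset.forall_mem_image]
          intro v hv
          rw [norm_smul, h1 v hv]; norm_num)
      (by simp only [Finset.forall_mem_image]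
          intro v hv w hw hvw
          have := h2 v hv w hw fun h => hvw (by rw [h])
          rw [← smul_sub, norm_smul]
          norm_num
          linarith)
    rw [Finset.card_image_of_injective _ hinj] at this
    simpa using this
  -- If no separated set were a net, each could be enlarged by a point far from it, giving separated
  -- sets of every size and in particular of size `5 ^ d + 1`.
  by_contra hcon
  push Not at hcon
  have hall : ∀ n : ℕ, ∃ s : Finset (Vec d), (∀ v ∈ s, ‖v‖ = 1) ∧
      (∀ v ∈ s, ∀ w ∈ s, v ≠ w → 1 / 2 < ‖v - w‖) ∧ s.card = n := by
    intro n
    induction n with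
    | zero => exact ⟨∅, by simp, by simp, by simp⟩
    | succ n ih =>
      obtain ⟨s, h1, h2, h3⟩ := ih
      obtain ⟨u, hu, hus⟩ := hcon s h1 (hcard s h1 h2)
      refine ⟨insert u s, ?_, ?_, ?_⟩
      · simpa using ⟨hu, h1⟩
      · intro v hv w hw hvw
        rcases Finset.mem_insert.1 hv with hv' | hv' <;> rcases Finset.mem_insert.1 hw with hw' | hw'
        · exact absurd (hv'.trans hw'.symm) hvw
        · rw [hv']; exact hus w hw'
        · rw [hw', norm_sub_rev]; exact hus v hv'
        · exact h2 v hv' w hw' hvw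
      · rw [Finset.card_insert_of_notMem, h3]
        intro h
        have := hus u h
        norm_num at this
  obtain ⟨s, h1, h2, h3⟩ := hall (5 ^ d + 1)
  have := hcard s h1 h2
  omega

/-- Approximating a unit vector by a net point costs at most `‖A‖/2`, which is absorbed on the left.
-/
lemma opNorm_le_of_half_net {d : ℕ} {F : Type*} [NormedAddCommGroup F] [NormedSpace ℝ F]
    {N : Finset (Vec d)} (hN : ∀ u : Vec d, ‖u‖ = 1 → ∃ v ∈ N, ‖u - v‖ ≤ 1 / 2)
    (A : Vec d →L[ℝ] F) {c : ℝ} (hc : 0 ≤ c) (h : ∀ v ∈ N, ‖A v‖ ≤ c) : ‖A‖ ≤ 2 * c := by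
  have h1 : ‖A‖ ≤ c + ‖A‖ / 2 := by
    refine ContinuousLinearMap.opNorm_le_of_unit_norm (by positivity) fun u hu => ?_
    obtain ⟨v, hv, huv⟩ := hN u hu
    calc ‖A u‖ = ‖A v + A (u - v)‖ := by rw [← map_add]; congr 2; abel
      _ ≤ ‖A v‖ + ‖A (u - v)‖ := norm_add_le _ _
      _ ≤ c + ‖A‖ * (1 / 2) := add_le_add (h v hv)
          ((A.le_opNorm _).trans (mul_le_mul_of_nonneg_left huv (norm_nonneg _)))
      _ = _ := by ring
  linarith

end Net

/-! ### Ridge regression and its minimizer. -/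

section Ridge

variable {m n ι : Type*} [Fintype m] [Fintype n] [Fintype ι] [DecidableEq n]

/-- The first-order condition of ridge regression kills the cross term of the expansion of the
objective. -/
lemma ridge_cross_eq_zero {lam : ℝ} {f : ι → n → ℝ} {y : ι → m → ℝ} {W : Matrix m n ℝ}
    (hW : W * (lam • 1 + ∑ i, vecMulVec (f i) (f i)) = ∑ i, vecMulVec (y i) (f i))
    (D : Matrix m n ℝ) :
    ∑ i, (W *ᵥ f i - y i) ⬝ᵥ (D *ᵥ f i) + lam * ∑ a, ∑ b, W a b * D a b = 0 := by
  have h : ∀ a b, lam * W a b + ∑ i, (W *ᵥ f i - y i) a * f i b = 0 := by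
    intro a b
    have h1 := congrFun (congrFun hW a) b
    rw [Matrix.mul_add, Matrix.mul_sum] at h1
    simp only [Matrix.add_apply, Matrix.sum_apply, mul_vecMulVec, vecMulVec_apply,
      Matrix.mul_smul, Matrix.mul_one, Matrix.smul_apply, smul_eq_mul] at h1
    simp only [Pi.sub_apply, sub_mul, Finset.sum_sub_distrib]
    linarith
  have h2 : ∀ i, (W *ᵥ f i - y i) ⬝ᵥ (D *ᵥ f i) =
      ∑ a, ∑ b, D a b * ((W *ᵥ f i - y i) a * f i b) := by
    intro i
    simp only [dotProduct, mulVec, Finset.mul_sum]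
    exact Finset.sum_congr rfl fun a _ => Finset.sum_congr rfl fun b _ => by ring
  simp_rw [h2]
  rw [Finset.sum_comm, Finset.mul_sum, ← Finset.sum_add_distrib]
  refine Finset.sum_eq_zero fun a _ => ?_
  rw [Finset.sum_comm, Finset.mul_sum, ← Finset.sum_add_distrib]
  refine Finset.sum_eq_zero fun b _ => ?_
  rw [← Finset.mul_sum]
  have := h a b
  calc _ = D a b * (lam * W a b + ∑ i, (W *ᵥ f i - y i) a * f i b) := by ring
    _ = 0 := by rw [this, mul_zero]

end Ridge

section Ball

variable {dX dφ H : ℕ} {U : Type*}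

/-- The cross moment `∑ x_{h+1} φ(x_h, u_h)ᵀ` of the data. -/
def crossMoment (φ : Vec dX → U → Vec dφ) {t : ℕ} (hist : History dX H U t) : Param dX dφ :=
  ∑ τ : Fin t, ∑ h : Fin H, vecMulVec ((hist τ).1 h.succ).ofLp (feat φ (hist τ) h).ofLp

lemma featureCov_eq (φ : Vec dX → U → Vec dφ) (lam : ℝ) {t : ℕ} (hist : History dX H U t) :
    featureCov φ lam hist = lam • 1 + ∑ p : Fin t × Fin H,
      vecMulVec (feat φ (hist p.1) p.2).ofLp (feat φ (hist p.1) p.2).ofLp := by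
  rw [Fintype.sum_prod_type]; rfl

lemma posDef_smul_one {n : Type*} [Fintype n] [DecidableEq n] {lam : ℝ} (hlam : 0 < lam) :
    (lam • (1 : Matrix n n ℝ)).PosDef :=
  Matrix.PosDef.one.smul hlam

lemma posDef_featureCov (φ : Vec dX → U → Vec dφ) {lam : ℝ} (hlam : 0 < lam) {t : ℕ}
    (hist : History dX H U t) : (featureCov φ lam hist).PosDef := by
  rw [featureCov_eq]
  exact posDef_add_sum_vecMulVec (posDef_smul_one hlam) _ _

/-- At a solution of the normal equations the expansion has no linear term, and the quadratic
remainder is positive for `D ≠ 0` when `lam > 0`. Existence and uniqueness of the minimizer both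
follow. -/
lemma ridgeLoss_eq_add (φ : Vec dX → U → Vec dφ) (lam : ℝ) {t : ℕ} (hist : History dX H U t)
    {W : Param dX dφ} (hW : W * featureCov φ lam hist = crossMoment φ hist) (D : Param dX dφ) :
    ridgeLoss φ lam hist (W + D) = ridgeLoss φ lam hist W +
      (∑ p : Fin t × Fin H, ‖Matrix.toEuclideanLin D (feat φ (hist p.1) p.2)‖ ^ 2
        + lam * frobSq D) := by
  have hc := ridge_cross_eq_zero (lam := lam) (W := W) (ι := Fin t × Fin H)
    (f := fun p => (feat φ (hist p.1) p.2).ofLp) (y := fun p => ((hist p.1).1 p.2.succ).ofLp)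
    (by rw [← featureCov_eq, hW, Fintype.sum_prod_type]; rfl) D
  have hl : ∀ W, ridgeLoss φ lam hist W = ∑ p : Fin t × Fin H,
      ‖Matrix.toEuclideanLin W (feat φ (hist p.1) p.2) - (hist p.1).1 p.2.succ‖ ^ 2
        + lam * frobSq W := fun W => by
    rw [Fintype.sum_prod_type]; rfl
  have h1 : ∀ p : Fin t × Fin H,
      ‖Matrix.toEuclideanLin (W + D) (feat φ (hist p.1) p.2) - (hist p.1).1 p.2.succ‖ ^ 2 =
      ‖Matrix.toEuclideanLin W (feat φ (hist p.1) p.2) - (hist p.1).1 p.2.succ‖ ^ 2 +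
      2 * ((W *ᵥ (feat φ (hist p.1) p.2).ofLp - ((hist p.1).1 p.2.succ).ofLp) ⬝ᵥ
        (D *ᵥ (feat φ (hist p.1) p.2).ofLp)) +
      ‖Matrix.toEuclideanLin D (feat φ (hist p.1) p.2)‖ ^ 2 := by
    intro p
    rw [map_add, LinearMap.add_apply, add_sub_right_comm, norm_add_sq_real]
    congr 3
    simp [PiLp.inner_apply, dotProduct, Matrix.toLpLin_apply, mul_comm]
  have h2 : frobSq (W + D) = frobSq W + 2 * ∑ a, ∑ b, W a b * D a b + frobSq D := by
    simp only [frobSq, Finset.mul_sum, ← Finset.sum_add_distrib, Matrix.add_apply]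
    exact Finset.sum_congr rfl fun a _ => Finset.sum_congr rfl fun b _ => by ring
  rw [hl, hl, h2]
  simp_rw [h1]
  rw [Finset.sum_add_distrib, Finset.sum_add_distrib, ← Finset.mul_sum]
  linarith

lemma frobSq_nonneg {m n : ℕ} (M : Matrix (Fin m) (Fin n) ℝ) : 0 ≤ frobSq M :=
  Finset.sum_nonneg fun _ _ => Finset.sum_nonneg fun _ _ => sq_nonneg _

lemma eq_zero_of_frobSq_nonpos {m n : ℕ} {M : Matrix (Fin m) (Fin n) ℝ} (h : frobSq M ≤ 0) :
    M = 0 := by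
  have h0 := le_antisymm h (frobSq_nonneg M)
  have h1 := (Finset.sum_eq_zero_iff_of_nonneg (s := Finset.univ) (f := fun a => ∑ b, M a b ^ 2)
    fun a _ => Finset.sum_nonneg fun b _ => sq_nonneg (M a b)).1 h0
  ext a b
  have h2 := (Finset.sum_eq_zero_iff_of_nonneg (s := Finset.univ) (f := fun b => M a b ^ 2)
    fun b _ => sq_nonneg (M a b)).1 (h1 a (Finset.mem_univ a))
  simpa using h2 b (Finset.mem_univ b)

/-- The ridge regression objective has the unique minimizer `(∑ x_{h+1} φᵀ) Σ⁻¹`. -/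
lemma ridge_minimizer_iff (φ : Vec dX → U → Vec dφ) {lam : ℝ} (hlam : 0 < lam) {t : ℕ}
    (hist : History dX H U t) (W : Param dX dφ) :
    (∀ W', ridgeLoss φ lam hist W ≤ ridgeLoss φ lam hist W') ↔
      W = crossMoment φ hist * (featureCov φ lam hist)⁻¹ := by
  have hu : IsUnit (featureCov φ lam hist).det :=
    (isUnit_iff_isUnit_det _).1 (posDef_featureCov φ hlam hist).isUnit
  set W1 := crossMoment φ hist * (featureCov φ lam hist)⁻¹ with hW1
  have h1 : W1 * featureCov φ lam hist = crossMoment φ hist := by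
    rw [hW1, Matrix.mul_assoc, nonsing_inv_mul _ hu, Matrix.mul_one]
  constructor
  · intro h
    have h2 := ridgeLoss_eq_add φ lam hist h1 (W - W1)
    have h3 := h W1
    rw [add_sub_cancel] at h2
    have h4 : 0 ≤ ∑ p : Fin t × Fin H,
        ‖Matrix.toEuclideanLin (W - W1) (feat φ (hist p.1) p.2)‖ ^ 2 :=
      Finset.sum_nonneg fun _ _ => sq_nonneg _
    have h5 : frobSq (W - W1) ≤ 0 := by
      by_contra h6
      have := mul_pos hlam (not_le.1 h6)
      linarith
    exact sub_eq_zero.1 (eq_zero_of_frobSq_nonpos h5)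
  · rintro rfl W'
    have h2 := ridgeLoss_eq_add φ lam hist h1 (W' - W1)
    rw [add_sub_cancel] at h2
    have h4 : 0 ≤ ∑ p : Fin t × Fin H,
        ‖Matrix.toEuclideanLin (W' - W1) (feat φ (hist p.1) p.2)‖ ^ 2 :=
      Finset.sum_nonneg fun _ _ => sq_nonneg _
    have h5 := mul_nonneg hlam.le (frobSq_nonneg (W' - W1))
    linarith

end Ball

/-! ### Spectral norms and the metric of the covariance. -/

section SpecNorm

variable {m n k : ℕ}

lemma specNorm_nonneg (M : Matrix (Fin m) (Fin n) ℝ) : 0 ≤ specNorm M := norm_nonneg _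

lemma norm_toEuclideanLin_le (M : Matrix (Fin m) (Fin n) ℝ) (v : Vec n) :
    ‖Matrix.toEuclideanLin M v‖ ≤ specNorm M * ‖v‖ :=
  (LinearMap.toContinuousLinearMap (Matrix.toEuclideanLin M)).le_opNorm v

lemma specNorm_le {M : Matrix (Fin m) (Fin n) ℝ} {c : ℝ} (hc : 0 ≤ c)
    (h : ∀ v : Vec n, ‖Matrix.toEuclideanLin M v‖ ≤ c * ‖v‖) : specNorm M ≤ c :=
  ContinuousLinearMap.opNorm_le_bound _ hc h

open scoped Matrix.Norms.L2Operator in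
lemma specNorm_eq_l2 (M : Matrix (Fin m) (Fin n) ℝ) : specNorm M = ‖M‖ := rfl

open scoped Matrix.Norms.L2Operator in
lemma specNorm_transpose (M : Matrix (Fin m) (Fin n) ℝ) : specNorm Mᵀ = specNorm M := by
  rw [specNorm_eq_l2, specNorm_eq_l2, ← l2_opNorm_conjTranspose M, conjTranspose_eq_transpose_of_trivial]

open scoped Matrix.Norms.L2Operator in
lemma specNorm_sub_le (M M' : Matrix (Fin m) (Fin n) ℝ) :
    specNorm (M - M') ≤ specNorm M + specNorm M' := by
  simp only [specNorm_eq_l2]; exact norm_sub_le _ _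

open scoped Matrix.Norms.L2Operator in
lemma specNorm_smul (c : ℝ) (M : Matrix (Fin m) (Fin n) ℝ) :
    specNorm (c • M) = |c| * specNorm M := by
  simp only [specNorm_eq_l2, norm_smul, Real.norm_eq_abs]

open scoped Matrix.Norms.L2Operator in
lemma specNorm_pos {M : Matrix (Fin m) (Fin n) ℝ} (hM : M ≠ 0) : 0 < specNorm M := by
  rw [specNorm_eq_l2]; exact norm_pos_iff.2 hM

lemma toEuclideanLin_mul (M : Matrix (Fin m) (Fin n) ℝ) (M' : Matrix (Fin n) (Fin k) ℝ)
    (v : Vec k) : Matrix.toEuclideanLin (M * M') v =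
      Matrix.toEuclideanLin M (Matrix.toEuclideanLin M' v) := by
  simp [Matrix.toLpLin_apply, Matrix.mulVec_mulVec]

open scoped MatrixOrder

variable {S : Matrix (Fin n) (Fin n) ℝ}

lemma sqrt_spec (hS : S.PosDef) : (CFC.sqrt S)ᵀ = CFC.sqrt S ∧ CFC.sqrt S * CFC.sqrt S = S ∧
    IsUnit (CFC.sqrt S).det := by
  have h1 : CFC.sqrt S * CFC.sqrt S = S := CFC.sqrt_mul_sqrt_self S hS.posSemidef.nonneg
  refine ⟨?_, h1, ?_⟩
  · have := (CFC.sqrt_nonneg S).isSelfAdjoint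
    rwa [IsSelfAdjoint, star_eq_conjTranspose, conjTranspose_eq_transpose_of_trivial] at this
  · have h2 : (CFC.sqrt S).det * (CFC.sqrt S).det = S.det := by rw [← det_mul, h1]
    refine isUnit_iff_ne_zero.2 fun h => hS.det_pos.ne' ?_
    rw [← h2, h, mul_zero]

lemma norm_sq_inv_sqrt (hS : S.PosDef) (v : Vec n) :
    ‖Matrix.toEuclideanLin (CFC.sqrt S)⁻¹ v‖ ^ 2 = invQuad S v.ofLp := by
  obtain ⟨h1, h2, h3⟩ := sqrt_spec hS
  have h4 : S⁻¹ = (CFC.sqrt S)⁻¹ * (CFC.sqrt S)⁻¹ := by rw [← Matrix.mul_inv_rev, h2]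
  have h5 : ((CFC.sqrt S)⁻¹)ᵀ = (CFC.sqrt S)⁻¹ := by rw [transpose_nonsing_inv, h1]
  rw [EuclideanSpace.real_norm_sq_eq, invQuad, h4, ← mulVec_mulVec, dotProduct_mulVec,
    ← mulVec_transpose, h5]
  simp [dotProduct, sq, Matrix.toLpLin_apply]

/-- Factor `M = (M √S) (√S)⁻¹`; the second factor turns the Euclidean norm into `invQuad S`. -/
lemma norm_sq_toEuclideanLin_le (hS : S.PosDef) (M : Matrix (Fin m) (Fin n) ℝ) (v : Vec n) :
    ‖Matrix.toEuclideanLin M v‖ ^ 2 ≤ specNorm (M * CFC.sqrt S) ^ 2 * invQuad S v.ofLp := by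
  obtain ⟨h1, h2, h3⟩ := sqrt_spec hS
  have h4 : M = M * CFC.sqrt S * (CFC.sqrt S)⁻¹ := by
    rw [Matrix.mul_assoc, mul_nonsing_inv _ h3, Matrix.mul_one]
  rw [← norm_sq_inv_sqrt hS, ← mul_pow]
  refine pow_le_pow_left₀ (norm_nonneg _) ?_ 2
  conv_lhs => rw [h4, toEuclideanLin_mul]
  exact norm_toEuclideanLin_le _ _

/-- Expresses `Σ⁻¹ ≤ 1/lam`. With `w = S⁻¹ v`, `lam ‖w‖² ≤ wᵀ S w = v ⬝ w`, while `v ⬝ w ≤ (lam ‖w‖²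
+ ‖v‖²/lam)/2`. -/
lemma invQuad_le_div {lam : ℝ} (hlam : 0 < lam) {ι : Type*} [Fintype ι] (f : ι → Fin n → ℝ)
    (v : Vec n) : invQuad (lam • 1 + ∑ i, vecMulVec (f i) (f i)) v.ofLp ≤ ‖v‖ ^ 2 / lam := by
  set S := lam • 1 + ∑ i, vecMulVec (f i) (f i) with hSdef
  have hS : S.PosDef := posDef_add_sum_vecMulVec (posDef_smul_one hlam) _ _
  have hu : IsUnit S.det := (isUnit_iff_isUnit_det _).1 hS.isUnit
  set w := S⁻¹ *ᵥ v.ofLp with hw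
  have h1 : S *ᵥ w = v.ofLp := by rw [hw, mulVec_mulVec, mul_nonsing_inv _ hu, one_mulVec]
  have h2 : invQuad S v.ofLp = w ⬝ᵥ S *ᵥ w := by rw [h1, dotProduct_comm]; rfl
  have h3 : lam * (w ⬝ᵥ w) ≤ w ⬝ᵥ S *ᵥ w := by
    have := (posSemidef_sum Finset.univ fun i _ =>
      posSemidef_vecMulVec_self (f i)).dotProduct_mulVec_nonneg w
    rw [hSdef, add_mulVec, dotProduct_add, smul_mulVec, one_mulVec, dotProduct_smul, smul_eq_mul]
    simpa using this
  have h4 : v.ofLp ⬝ᵥ w ≤ (lam * (w ⬝ᵥ w) + ‖v‖ ^ 2 / lam) / 2 := by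
    rw [EuclideanSpace.real_norm_sq_eq, Finset.sum_div]
    simp only [dotProduct, Finset.mul_sum]
    rw [← Finset.sum_add_distrib, Finset.sum_div]
    refine Finset.sum_le_sum fun i _ => ?_
    have : (lam * (w i * w i) + v i ^ 2 / lam) / 2 - v i * w i = (lam * w i - v i) ^ 2 / (2 * lam) := by
      field_simp; ring
    have : 0 ≤ (lam * w i - v i) ^ 2 / (2 * lam) := by positivity
    change v i * w i ≤ _
    linarith
  have h5 : invQuad S v.ofLp = v.ofLp ⬝ᵥ w := rfl
  linarith

end SpecNorm
end LC3

namespace LC3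
open Matrix
open scoped RealInnerProductSpace MatrixOrder

/-! ### Confidence balls: the true parameter belongs to them. -/

section Confidence

variable {dX dφ H : ℕ} {U : Type*}

/-- The noise-weighted feature sum `∑ ⟨v, x_{h+1} - W φ(x_h, u_h)⟩ φ(x_h, u_h)` of one trajectory. -/
noncomputable def trajNoise (φ : Vec dX → U → Vec dφ) (W : Param dX dφ) (v : Vec dX) (τ : Traj dX H U) :
    Fin dφ → ℝ :=
  ∑ h : Fin H, ⟪v, τ.1 h.succ - Matrix.toEuclideanLin W (feat φ τ h)⟫ • (feat φ τ h).ofLp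

/-- The noise-weighted feature sum of a history. -/
noncomputable def histNoise (φ : Vec dX → U → Vec dφ) (W : Param dX dφ) (v : Vec dX) {t : ℕ}
    (hist : History dX H U t) : Fin dφ → ℝ :=
  ∑ i : Fin t, trajNoise φ W v (hist i)

/-- The sum of the self-normalized likelihood ratios over the directions in `N`. -/
noncomputable def noiseStat (φ : Vec dX → U → Vec dφ) (lam σ : ℝ) (W : Param dX dφ) (N : Finset (Vec dX)) {t : ℕ}
    (hist : History dX H U t) : ℝ≥0∞ :=
  ∑ v ∈ N, selfNorm σ (featureCov φ lam hist) (histNoise φ W v hist)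

/-- Both parameters are within `√β` of the same center, by uniqueness of the minimizer; the factor
`4` comes from `(p + q)² ≤ 2p² + 2q²`. -/
lemma norm_sub_sq_le_of_mem_ball (φ : Vec dX → U → Vec dφ) {C₁ lam σ w : ℝ} (hlam : 0 < lam)
    {Ball₀ : Set (Param dX dφ)} {t : ℕ} (ht : t ≠ 0) {hist : History dX H U t}
    {W W' : Param dX dφ} (hW : W ∈ ball φ C₁ lam σ w Ball₀ hist)
    (hW' : W' ∈ ball φ C₁ lam σ w Ball₀ hist) (f : Vec dφ) :
    ‖Matrix.toEuclideanLin (W - W') f‖ ^ 2 ≤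
      4 * beta φ C₁ lam σ w hist * invQuad (featureCov φ lam hist) f.ofLp := by
  rw [ball, if_neg ht] at hW hW'
  obtain ⟨Wb, h1, h2⟩ := hW
  obtain ⟨Wb', h1', h2'⟩ := hW'
  have hS := posDef_featureCov φ hlam hist
  obtain rfl : Wb = Wb' := ((ridge_minimizer_iff φ hlam hist Wb).1 h1).trans
    ((ridge_minimizer_iff φ hlam hist Wb').1 h1').symm
  have hq := invQuad_nonneg hS f.ofLp
  have h3 := (norm_sq_toEuclideanLin_le hS (W - Wb) f).trans (mul_le_mul_of_nonneg_right h2 hq)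
  have h4 := (norm_sq_toEuclideanLin_le hS (W' - Wb) f).trans (mul_le_mul_of_nonneg_right h2' hq)
  have h5 : ‖Matrix.toEuclideanLin (W - W') f‖ ≤
      ‖Matrix.toEuclideanLin (W - Wb) f‖ + ‖Matrix.toEuclideanLin (W' - Wb) f‖ := by
    have : Matrix.toEuclideanLin (W - W') f =
        Matrix.toEuclideanLin (W - Wb) f - Matrix.toEuclideanLin (W' - Wb) f := by
      rw [← LinearMap.sub_apply, ← map_sub, sub_sub_sub_cancel_right]
    rw [this]; exact norm_sub_le _ _
  have h6 := pow_le_pow_left₀ (norm_nonneg _) h5 2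
  nlinarith [sq_nonneg (‖Matrix.toEuclideanLin (W - Wb) f‖ - ‖Matrix.toEuclideanLin (W' - Wb) f‖)]

/-- The left-hand matrix is the noise matrix `∑ ε φᵀ`. Testing its transpose against `v` leaves a
scalar noise, to which the mixture martingale applies. -/
lemma crossMoment_sub_transpose_mulVec (φ : Vec dX → U → Vec dφ) (lam : ℝ) (W : Param dX dφ)
    {t : ℕ} (hist : History dX H U t) (v : Vec dX) :
    (crossMoment φ hist - W * (featureCov φ lam hist - lam • 1))ᵀ *ᵥ v.ofLp =
      histNoise φ W v hist := by
  have hE : crossMoment φ hist - W * (featureCov φ lam hist - lam • 1) =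
      ∑ i : Fin t, ∑ h : Fin H, vecMulVec ((hist i).1 h.succ -
        Matrix.toEuclideanLin W (feat φ (hist i) h)).ofLp (feat φ (hist i) h).ofLp := by
    have : featureCov φ lam hist - lam • 1 = ∑ i : Fin t, ∑ h : Fin H,
      vecMulVec (feat φ (hist i) h).ofLp (feat φ (hist i) h).ofLp := add_sub_cancel_left _ _
    rw [this, crossMoment, Matrix.mul_sum, ← Finset.sum_sub_distrib]
    refine Finset.sum_congr rfl fun i _ => ?_
    rw [Matrix.mul_sum, ← Finset.sum_sub_distrib]
    refine Finset.sum_congr rfl fun h _ => ?_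
    rw [mul_vecMulVec, WithLp.ofLp_sub, sub_vecMulVec]
    rfl
  rw [hE, mulVec_transpose, histNoise]
  ext b
  simp only [vecMul, dotProduct, Matrix.sum_apply, vecMulVec_apply, trajNoise, Finset.sum_apply,
    Pi.smul_apply, smul_eq_mul, PiLp.inner_apply, Finset.mul_sum, Finset.sum_mul]
  rw [Finset.sum_comm]
  refine Finset.sum_congr rfl fun i _ => ?_
  rw [Finset.sum_comm]
  refine Finset.sum_congr rfl fun h _ => Finset.sum_congr rfl fun a _ => ?_
  simp
  ring

/-- The estimation error times `Σ^{1/2}` is a regularisation bias minus a noise term, of spectral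
norms at most `√lam ‖W‖` and `2√K`. Then `(b + 2k)² ≤ 3b² + 6k²`, the difference being `2(b - k)²`.
-/
lemma mem_ball_of_histNoise_le (φ : Vec dX → U → Vec dφ) {C₁ lam σ : ℝ} (hlam : 0 < lam)
    {Ball₀ : Set (Param dX dφ)} {t : ℕ} (ht : t ≠ 0) {hist : History dX H U t}
    {W : Param dX dφ} {N : Finset (Vec dX)}
    (hN : ∀ u : Vec dX, ‖u‖ = 1 → ∃ v ∈ N, ‖u - v‖ ≤ 1 / 2) {K : ℝ} (hK : 0 ≤ K)
    (h : ∀ v ∈ N, invQuad (featureCov φ lam hist) (histNoise φ W v hist) ≤ K)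
    (hβ : 3 * (lam * specNorm W ^ 2) + 6 * K ≤ beta φ C₁ lam σ (specNorm W) hist) :
    W ∈ ball φ C₁ lam σ (specNorm W) Ball₀ hist := by
  rw [ball, if_neg ht]
  set S := featureCov φ lam hist with hSdef
  have hS : S.PosDef := posDef_featureCov φ hlam hist
  have hu : IsUnit S.det := (isUnit_iff_isUnit_det _).1 hS.isUnit
  obtain ⟨hR1, hR2, hR3⟩ := sqrt_spec hS
  refine ⟨crossMoment φ hist * S⁻¹, (ridge_minimizer_iff φ hlam hist _).2 rfl, ?_⟩
  refine le_trans ?_ hβ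
  set R := CFC.sqrt S with hR
  set E := crossMoment φ hist - W * (S - lam • 1) with hE
  have hRinv : S⁻¹ * R = R⁻¹ := by
    have : S⁻¹ = R⁻¹ * R⁻¹ := by rw [← Matrix.mul_inv_rev, hR2]
    rw [this, Matrix.mul_assoc, nonsing_inv_mul _ hR3, Matrix.mul_one]
  have h1 : (W - crossMoment φ hist * S⁻¹) * R = lam • (W * R⁻¹) - E * R⁻¹ := by
    have : W * R = W * (S * S⁻¹) * R := by rw [mul_nonsing_inv _ hu, Matrix.mul_one]
    rw [Matrix.sub_mul, this, hE, ← Matrix.mul_assoc, Matrix.mul_assoc (W * S), hRinv,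
      Matrix.mul_assoc (crossMoment φ hist), hRinv, Matrix.sub_mul, Matrix.mul_sub, Matrix.sub_mul, Matrix.mul_smul,
      Matrix.mul_one, Matrix.smul_mul]
    abel
  have h2 : specNorm (lam • (W * R⁻¹)) ≤ √lam * specNorm W := by
    rw [specNorm_smul, abs_of_pos hlam]
    have h3 : specNorm (W * R⁻¹) ≤ specNorm W * (√lam)⁻¹ := by
      refine specNorm_le (mul_nonneg (specNorm_nonneg _) (by positivity)) fun v => ?_
      rw [toEuclideanLin_mul, mul_assoc]
      refine (norm_toEuclideanLin_le _ _).trans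
        (mul_le_mul_of_nonneg_left ?_ (specNorm_nonneg _))
      refine le_of_pow_le_pow_left₀ two_ne_zero (by positivity) ?_
      rw [norm_sq_inv_sqrt hS, hSdef, featureCov_eq]
      refine (invQuad_le_div hlam _ v).trans_eq ?_
      rw [mul_pow, inv_pow, Real.sq_sqrt hlam.le]
      ring
    calc lam * specNorm (W * R⁻¹) ≤ lam * (specNorm W * (√lam)⁻¹) :=
          mul_le_mul_of_nonneg_left h3 hlam.le
      _ = (lam * (√lam)⁻¹) * specNorm W := by ring
      _ = _ := by rw [← div_eq_mul_inv, Real.div_sqrt]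
  have h4 : specNorm (E * R⁻¹) ≤ 2 * √K := by
    -- Transposing lets the net live in the output space `ℝ^dX`, so that its cardinality contributes
    -- `dX` and not `dφ` to the radius.
    have hRt : (R⁻¹)ᵀ = R⁻¹ := by rw [transpose_nonsing_inv, hR1]
    rw [← specNorm_transpose, transpose_mul, hRt]
    refine opNorm_le_of_half_net hN _ (Real.sqrt_nonneg _) fun v hv => ?_
    change ‖Matrix.toEuclideanLin (R⁻¹ * Eᵀ) v‖ ≤ _
    refine Real.le_sqrt_of_sq_le ?_
    rw [toEuclideanLin_mul, norm_sq_inv_sqrt hS]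
    refine le_of_eq_of_le ?_ (h v hv)
    rw [← crossMoment_sub_transpose_mulVec φ lam W hist v]
    rfl
  have h5 : specNorm ((W - crossMoment φ hist * S⁻¹) * R) ≤ √lam * specNorm W + 2 * √K := by
    rw [h1]
    exact (specNorm_sub_le _ _).trans (add_le_add h2 h4)
  have h6 := pow_le_pow_left₀ (specNorm_nonneg _) h5 2
  have h7 := Real.sq_sqrt hlam.le
  have h8 := Real.sq_sqrt hK
  nlinarith [sq_nonneg (2 * (√lam * specNorm W) - 2 * √K)]

lemma featureCov_det_ge (φ : Vec dX → U → Vec dφ) {lam : ℝ} (hlam : 0 < lam) {t : ℕ}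
    (hist : History dX H U t) :
    (lam • (1 : Matrix (Fin dφ) (Fin dφ) ℝ)).det ≤ (featureCov φ lam hist).det := by
  have hS : (lam • (1 : Matrix (Fin dφ) (Fin dφ) ℝ)).PosDef := posDef_smul_one hlam
  rw [featureCov_eq]
  refine le_trans ?_ (det_mul_one_add_sum_invQuad_le hS _)
  have h := Finset.sum_nonneg fun (p : Fin t × Fin H) (_ : p ∈ Finset.univ) =>
    invQuad_nonneg hS (feat φ (hist p.1) p.2).ofLp
  nlinarith [hS.det_pos]

/-- The log-volume ratio `log (det Σ^t / det Σ^0)`. -/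
noncomputable def logDetRatio (φ : Vec dX → U → Vec dφ) (lam : ℝ) {t : ℕ} (hist : History dX H U t) : ℝ :=
  Real.log ((featureCov φ lam hist).det / (lam • (1 : Matrix (Fin dφ) (Fin dφ) ℝ)).det)

lemma logDetRatio_nonneg (φ : Vec dX → U → Vec dφ) {lam : ℝ} (hlam : 0 < lam) {t : ℕ}
    (hist : History dX H U t) : 0 ≤ logDetRatio φ lam hist :=
  Real.log_nonneg ((one_le_div (posDef_smul_one hlam).det_pos).2 (featureCov_det_ge φ hlam hist))

lemma beta_eq (φ : Vec dX → U → Vec dφ) {C₁ lam σ w : ℝ} (hlam : 0 < lam)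
    (hw : lam * w ^ 2 = σ ^ 2) {t : ℕ} (ht : t ≠ 0) (hist : History dX H U t) :
    beta φ C₁ lam σ w hist =
      C₁ * σ ^ 2 * (1 + dX + Real.log t + logDetRatio φ lam hist) := by
  have h1 := (posDef_featureCov φ hlam hist).det_pos
  have h2 := (posDef_smul_one (n := Fin dφ) hlam).det_pos
  have h3 : (t : ℝ) ≠ 0 := by exact_mod_cast ht
  rw [beta, hw, mul_div_assoc, Real.log_mul h3 (div_pos h1 h2).ne', logDetRatio]
  ring

/-- On the event that the noise statistic is moderate, the true parameter is in the ball. -/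
lemma mem_ball_of_noiseStat_lt (φ : Vec dX → U → Vec dφ) {lam σ : ℝ} (hσ : 0 < σ) (hlam : 0 < lam)
    {Ball₀ : Set (Param dX dφ)} {t : ℕ} (ht : t ≠ 0) {hist : History dX H U t}
    {W : Param dX dφ} (hw : lam * specNorm W ^ 2 = σ ^ 2) {N : Finset (Vec dX)}
    (hN : ∀ u : Vec dX, ‖u‖ = 1 → ∃ v ∈ N, ‖u - v‖ ≤ 1 / 2)
    (h : noiseStat φ lam σ W N hist < ENNReal.ofReal (5 ^ dX * (4 * t)) *
      selfNorm σ (lam • (1 : Matrix (Fin dφ) (Fin dφ) ℝ)) 0) :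
    W ∈ ball φ 20 lam σ (specNorm W) Ball₀ hist := by
  have hS := posDef_featureCov φ hlam hist
  have hd := hS.det_pos
  have hd0 := (posDef_smul_one (n := Fin dφ) hlam).det_pos
  have ht1 : (1 : ℝ) ≤ t := by exact_mod_cast Nat.one_le_iff_ne_zero.2 ht
  have hl := logDetRatio_nonneg φ hlam hist
  have hlt := Real.log_nonneg ht1
  -- Equivalent to `5³ = 125 ≤ e⁵`.
  have hl5 : Real.log 5 ≤ 5 / 3 := by
    rw [Real.log_le_iff_le_exp (by norm_num)]
    have h1 : (5 : ℝ) ^ 3 ≤ Real.exp (5 / 3) ^ 3 := by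
      rw [← Real.exp_nat_mul]
      have h2 : Real.exp ((3 : ℕ) * (5 / 3)) = Real.exp 1 ^ 5 := by
        rw [← Real.exp_nat_mul]; norm_num
      rw [h2]
      have h3 := Real.exp_one_gt_d9.le
      calc (5 : ℝ) ^ 3 ≤ 2.7182818283 ^ 5 := by norm_num
        _ ≤ _ := pow_le_pow_left₀ (by norm_num) h3 5
    exact le_of_pow_le_pow_left₀ (by norm_num) (Real.exp_pos _).le h1
  have hl50 : 0 ≤ Real.log 5 := Real.log_nonneg (by norm_num)
  have hl4 : Real.log 4 = 2 * Real.log 2 := by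
    rw [show (4 : ℝ) = 2 ^ 2 by norm_num, Real.log_pow]; norm_num
  have hl2 := Real.log_two_lt_d9
  have hl20 := Real.log_two_gt_d9
  -- `K` is the logarithm of the threshold `5^dX · 4t · √(det Σ^t / det Σ^0)` multiplied by `2σ²`.
  refine mem_ball_of_histNoise_le φ hlam ht hN (K := σ ^ 2 * (2 * (dX * Real.log 5) + 2 * Real.log 4
    + 2 * Real.log t + logDetRatio φ lam hist)) (by rw [hl4]; positivity) (fun v hv => ?_) ?_
  · have h1 : selfNorm σ (featureCov φ lam hist) (histNoise φ W v hist) ≤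
        ENNReal.ofReal (5 ^ dX * (4 * t)) *
          selfNorm σ (lam • (1 : Matrix (Fin dφ) (Fin dφ) ℝ)) 0 :=
      (Finset.single_le_sum (f := fun v => selfNorm σ (featureCov φ lam hist) (histNoise φ W v hist))
        (fun _ _ => zero_le) hv).trans h.le
    set q := invQuad (featureCov φ lam hist) (histNoise φ W v hist) with hq
    rw [selfNorm, selfNorm, ← ENNReal.ofReal_mul (by positivity), ENNReal.ofReal_le_ofReal_iff
      (by positivity), ← hq, show invQuad (lam • (1 : Matrix (Fin dφ) (Fin dφ) ℝ)) 0 = 0 by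
        simp [invQuad]] at h1
    rw [zero_div, Real.exp_zero, div_le_iff₀ (Real.sqrt_pos.2 hd)] at h1
    have h2 : 5 ^ dX * (4 * (t : ℝ)) * (1 / √(lam • (1 : Matrix (Fin dφ) (Fin dφ) ℝ)).det) *
        √(featureCov φ lam hist).det = 5 ^ dX * (4 * (t : ℝ)) *
          √((featureCov φ lam hist).det / (lam • (1 : Matrix (Fin dφ) (Fin dφ) ℝ)).det) := by
      rw [Real.sqrt_div hd.le]; ring
    have ht0 : (0 : ℝ) < t := by linarith
    have hr := div_pos hd hd0
    have h3 := Real.log_le_log (Real.exp_pos _) (h1.trans_eq h2)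
    rw [Real.log_exp, Real.log_mul (by positivity) (Real.sqrt_pos.2 hr).ne',
      Real.log_mul (by positivity) (by positivity), Real.log_mul (by norm_num) ht0.ne',
      Real.log_pow, Real.log_sqrt hr.le, div_le_iff₀ (by positivity)] at h3
    refine h3.trans_eq ?_
    rw [logDetRatio]
    ring
  · rw [beta_eq φ hlam hw ht, hw, hl4]
    have hdX : (0 : ℝ) ≤ dX := Nat.cast_nonneg _
    have h5 : (dX : ℝ) * Real.log 5 ≤ dX * (5 / 3) := mul_le_mul_of_nonneg_left hl5 hdX
    -- This fixes `C₁ = 20`: the constant is `3 + 24 log 2 < 20` and the coefficient of `dX` is `12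
    -- log 5 ≤ 20`.
    have key : 3 + 6 * (2 * (dX * Real.log 5) + 2 * (2 * Real.log 2) + 2 * Real.log t +
        logDetRatio φ lam hist) ≤ 20 * (1 + dX + Real.log t + logDetRatio φ lam hist) := by
      linarith
    have := mul_le_mul_of_nonneg_left key (sq_nonneg σ)
    linarith

end Confidence

/-! ### The elliptical potential. -/

section Potential

variable {dX dφ H : ℕ} {U : Type*}

lemma featureCov_succ (φ : Vec dX → U → Vec dφ) (lam : ℝ) (τ : ℕ → Traj dX H U) (t : ℕ) :
    featureCov φ lam (fun i : Fin (t + 1) => τ i) = featureCov φ lam (fun i : Fin t => τ i) +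
      ∑ h, vecMulVec (feat φ (τ t) h).ofLp (feat φ (τ t) h).ofLp := by
  simp only [featureCov]
  rw [Fin.sum_univ_castSucc, ← add_assoc]
  rfl

/-- The total squared size of the features of a trajectory, in the metric of the inverse
covariance of a history. -/
noncomputable def trajQuad (φ : Vec dX → U → Vec dφ) (lam : ℝ) {t : ℕ} (hist : History dX H U t)
    (τ : Traj dX H U) : ℝ :=
  ∑ h, invQuad (featureCov φ lam hist) (feat φ τ h).ofLp

lemma trajQuad_nonneg (φ : Vec dX → U → Vec dφ) {lam : ℝ} (hlam : 0 < lam) {t : ℕ}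
    (hist : History dX H U t) (τ : Traj dX H U) : 0 ≤ trajQuad φ lam hist τ :=
  Finset.sum_nonneg fun _ _ => invQuad_nonneg (posDef_featureCov φ hlam hist) _

/-- Each episode raises the log-volume by the logarithm of one plus its total quadratic size.
Telescoping this in `sum_log_trajQuad_le` bounds the sum of the logarithms. -/
lemma logDetRatio_succ_ge (φ : Vec dX → U → Vec dφ) {lam : ℝ} (hlam : 0 < lam)
    (τ : ℕ → Traj dX H U) (t : ℕ) :
    logDetRatio φ lam (fun i : Fin t => τ i) +
      Real.log (1 + trajQuad φ lam (fun i : Fin t => τ i) (τ t)) ≤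
      logDetRatio φ lam (fun i : Fin (t + 1) => τ i) := by
  have hS := posDef_featureCov φ hlam (fun i : Fin t => τ i)
  have hd0 := (posDef_smul_one (n := Fin dφ) hlam).det_pos
  have hq := trajQuad_nonneg φ hlam (fun i : Fin t => τ i) (τ t)
  have h := det_mul_one_add_sum_invQuad_le hS fun h => (feat φ (τ t) h).ofLp
  rw [logDetRatio, logDetRatio, ← Real.log_mul (div_pos hS.det_pos hd0).ne' (by positivity),
    featureCov_succ]
  refine Real.log_le_log (mul_pos (div_pos hS.det_pos hd0) (by positivity)) ?_
  rw [div_mul_eq_mul_div]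
  exact div_le_div_of_nonneg_right h hd0.le

lemma logDetRatio_mono (φ : Vec dX → U → Vec dφ) {lam : ℝ} (hlam : 0 < lam)
    (τ : ℕ → Traj dX H U) : Monotone fun t => logDetRatio φ lam (fun i : Fin t => τ i) :=
  monotone_nat_of_le_succ fun t => by
    have h1 := logDetRatio_succ_ge φ hlam τ t
    have h2 := Real.log_nonneg (le_add_of_nonneg_right
      (trajQuad_nonneg φ hlam (fun i : Fin t => τ i) (τ t)) : (1 : ℝ) ≤ _)
    linarith

lemma sum_log_trajQuad_le (φ : Vec dX → U → Vec dφ) {lam : ℝ} (hlam : 0 < lam)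
    (τ : ℕ → Traj dX H U) (T : ℕ) :
    ∑ t ∈ Finset.range T, Real.log (1 + trajQuad φ lam (fun i : Fin t => τ i) (τ t)) ≤
      logDetRatio φ lam (fun i : Fin T => τ i) := by
  induction T with
  | zero => simpa using logDetRatio_nonneg φ hlam _
  | succ T ih =>
    rw [Finset.sum_range_succ]
    linarith [logDetRatio_succ_ge φ hlam τ T]

/-- The trace of `Σ^t / lam - 1` is at most `B² t H / lam`, and for a given trace the determinant is
largest when the eigenvalues are equal. -/
lemma logDetRatio_le (φ : Vec dX → U → Vec dφ) {lam : ℝ} (hlam : 0 < lam) {B : ℝ}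
    (hB : ∀ x u, ‖φ x u‖ ≤ B) {t : ℕ} (hist : History dX H U t) :
    logDetRatio φ lam hist ≤ dφ * Real.log (1 + B ^ 2 / lam * (t * H / dφ)) := by
  set A : Matrix (Fin dφ) (Fin dφ) ℝ := lam⁻¹ • ∑ p : Fin t × Fin H,
      vecMulVec (feat φ (hist p.1) p.2).ofLp (feat φ (hist p.1) p.2).ofLp with hA
  have hAp : A.PosSemidef :=
    (posSemidef_sum _ fun p _ => posSemidef_vecMulVec_self _).smul (inv_nonneg.2 hlam.le)
  have h1 : featureCov φ lam hist = lam • (1 + A) := by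
    rw [featureCov_eq, smul_add, hA, smul_inv_smul₀ hlam.ne']
  have hd0 := (posDef_smul_one (n := Fin dφ) hlam).det_pos
  have h2 : (featureCov φ lam hist).det / (lam • (1 : Matrix (Fin dφ) (Fin dφ) ℝ)).det =
      (1 + A).det := by
    rw [h1, det_smul, det_smul, det_one, mul_one, mul_div_cancel_left₀ _ (by positivity)]
  have htr : A.trace ≤ B ^ 2 / lam * (t * H) := by
    rw [hA, trace_smul, trace_sum, smul_eq_mul]
    have : ∑ p : Fin t × Fin H, (vecMulVec (feat φ (hist p.1) p.2).ofLp
        (feat φ (hist p.1) p.2).ofLp).trace ≤ ∑ p : Fin t × Fin H, B ^ 2 := by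
      refine Finset.sum_le_sum fun p _ => ?_
      rw [trace_vecMulVec]
      have h := pow_le_pow_left₀ (norm_nonneg _) (hB ((hist p.1).1 p.2.castSucc) ((hist p.1).2 p.2)) 2
      rw [EuclideanSpace.real_norm_sq_eq] at h
      simpa [dotProduct, sq, feat] using h
    rw [Finset.sum_const, Finset.card_univ, Fintype.card_prod, Fintype.card_fin, Fintype.card_fin,
      nsmul_eq_mul] at this
    calc _ ≤ lam⁻¹ * (((t * H : ℕ) : ℝ) * B ^ 2) :=
          mul_le_mul_of_nonneg_left this (inv_nonneg.2 hlam.le)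
      _ = _ := by push_cast; ring
  have htr0 : 0 ≤ A.trace := hAp.trace_nonneg
  have h3 := det_one_add_le hAp
  rw [Fintype.card_fin] at h3
  have hpos : 0 < (1 + A).det := by
    have := one_add_trace_le_det hAp
    linarith
  rw [logDetRatio, h2]
  calc _ ≤ Real.log ((1 + A.trace / dφ) ^ dφ) := Real.log_le_log hpos h3
    _ = dφ * Real.log (1 + A.trace / dφ) := Real.log_pow _ _
    _ ≤ _ := by
      refine mul_le_mul_of_nonneg_left (Real.log_le_log (by positivity) ?_) (Nat.cast_nonneg _)
      rw [← mul_div_assoc]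
      gcongr

/-- Use `log(1 + x) ≥ x/(1 + x)`, which is at least `x/2` on `[0, 1]` and at least `1/2` beyond. -/
lemma min_one_le_two_mul_log {x : ℝ} (hx : 0 ≤ x) : min x 1 ≤ 2 * Real.log (1 + x) := by
  have h := Real.one_sub_inv_le_log_of_pos (show 0 < 1 + x by linarith)
  rcases le_total x 1 with h1 | h1
  · rw [min_eq_left h1]
    have h2 : x / 2 ≤ 1 - (1 + x)⁻¹ := by
      rw [show 1 - (1 + x)⁻¹ = x / (1 + x) by field_simp; ring]
      exact div_le_div_of_nonneg_left hx (by linarith) (by linarith)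
    linarith
  · rw [min_eq_right h1]
    have h2 : (1 + x)⁻¹ ≤ 2⁻¹ := inv_anti₀ (by norm_num) (by linarith)
    linarith

/-- The truncated prediction width of a trajectory after a history. -/
noncomputable def width (φ : Vec dX → U → Vec dφ) (lam σ w : ℝ) {t : ℕ} (hist : History dX H U t)
    (τ : Traj dX H U) : ℝ :=
  min (4 * beta φ 20 lam σ w hist / σ ^ 2 * trajQuad φ lam hist τ) 1

/-- The elliptical potential bound for the truncated prediction widths. -/
lemma sum_width_le (φ : Vec dX → U → Vec dφ) {lam σ w : ℝ} (hσ : 0 < σ) (hlam : 0 < lam)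
    (hw : lam * w ^ 2 = σ ^ 2) (τ : ℕ → Traj dX H U) {T : ℕ} {L : ℝ}
    (hL : logDetRatio φ lam (fun i : Fin T => τ i) ≤ L) :
    ∑ t ∈ (Finset.range T).erase 0, width φ lam σ w (fun i : Fin t => τ i) (τ t) ≤
      160 * (1 + dX + Real.log T + L) * L := by
  have hL0 : 0 ≤ L := (logDetRatio_nonneg φ hlam _).trans hL
  have hlT : 0 ≤ Real.log (T : ℝ) := Real.log_natCast_nonneg T
  have hdX : (0 : ℝ) ≤ dX := Nat.cast_nonneg _
  have hpt : ∀ t ∈ (Finset.range T).erase 0, width φ lam σ w (fun i : Fin t => τ i) (τ t) ≤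
      80 * (1 + dX + Real.log T + L) *
        (2 * Real.log (1 + trajQuad φ lam (fun i : Fin t => τ i) (τ t))) := by
    intro t ht
    obtain ⟨ht0, htT⟩ := Finset.mem_erase.1 ht
    have htT' := Finset.mem_range.1 htT
    have hq := trajQuad_nonneg φ hlam (fun i : Fin t => τ i) (τ t)
    have hmono := (logDetRatio_mono φ hlam τ htT'.le).trans hL
    simp only at hmono
    have hlt : Real.log (t : ℝ) ≤ Real.log T :=
      Real.log_le_log (by exact_mod_cast Nat.pos_of_ne_zero ht0) (by exact_mod_cast htT'.le)
    have hlt0 : 0 ≤ Real.log (t : ℝ) := Real.log_natCast_nonneg t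
    have hl0 := logDetRatio_nonneg φ hlam (fun i : Fin t => τ i)
    have hb : 4 * beta φ 20 lam σ w (fun i : Fin t => τ i) / σ ^ 2 =
        80 * (1 + dX + Real.log t + logDetRatio φ lam (fun i : Fin t => τ i)) := by
      rw [beta_eq φ hlam hw ht0]
      field_simp
      ring
    rw [width, hb]
    set q := trajQuad φ lam (fun i : Fin t => τ i) (τ t) with hqdef
    refine le_trans ?_ (mul_le_mul_of_nonneg_left (min_one_le_two_mul_log hq) (by positivity))
    -- The coefficient `80 (1 + ⋯)`, with `80 = 4 · 20`, is at least `1`, so it can be pulled out of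
    -- the truncation at `1`.
    rw [mul_min_of_nonneg _ _ (by positivity)]
    refine min_le_min (mul_le_mul_of_nonneg_right (by linarith) hq) ?_
    linarith
  refine (Finset.sum_le_sum hpt).trans ?_
  rw [← Finset.mul_sum, ← Finset.mul_sum]
  have h1 : ∑ t ∈ (Finset.range T).erase 0,
      Real.log (1 + trajQuad φ lam (fun i : Fin t => τ i) (τ t)) ≤ L := by
    refine le_trans (Finset.sum_le_sum_of_subset_of_nonneg (Finset.erase_subset _ _)
      fun t _ _ => ?_) ((sum_log_trajQuad_le φ hlam τ T).trans hL)
    exact Real.log_nonneg (le_add_of_nonneg_right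
      (trajQuad_nonneg φ hlam (fun i : Fin t => τ i) (τ t)))
  calc _ ≤ 80 * (1 + dX + Real.log T + L) * (2 * L) :=
        mul_le_mul_of_nonneg_left (by linarith) (by positivity)
    _ = _ := by ring

end Potential
end LC3

namespace LC3
open Matrix
open scoped RealInnerProductSpace

/-! ### The interaction: independence of past and present, and the martingale over episodes. -/

section Interaction

variable {dX dφ H : ℕ} {U : Type*} [MeasurableSpace U]

lemma Measurable.alg_comp {alg : Algorithm dX H U}
    (halg : ∀ t h, Measurable fun p : History dX H U t × Vec dX => alg t p.1 h p.2)
    {Ω : Type*} [MeasurableSpace Ω] {t : ℕ} {f : Ω → History dX H U t} (hf : Measurable f)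
    (h : Fin H) : Measurable fun p : Ω × Vec dX => alg t (f p.1) h p.2 :=
  (halg t h).comp (f := fun p : Ω × Vec dX => (f p.1, p.2)) (by fun_prop)

lemma Measurable.feat_apply {φ : Vec dX → U → Vec dφ} (hφ : Measurable (Function.uncurry φ))
    {Ω : Type*} [MeasurableSpace Ω] {f : Ω → Traj dX H U} (hf : Measurable f) (h : Fin H)
    (i : Fin dφ) : Measurable fun x => feat φ (f x) h i := by
  have := (measurable_feat (H := H) hφ h).comp hf
  simp only [Function.comp_def] at this
  fun_prop

/-- The σ-algebra on `Ω` is arbitrary and only the noise up to `t` must be measurable. Taking the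
σ-algebra of the past noise gives adaptedness in `indepFun_runHist`. -/
lemma measurable_runTraj {φ : Vec dX → U → Vec dφ} (hφ : Measurable (Function.uncurry φ))
    (W : Param dX dφ) (x0 : Vec dX) {alg : Algorithm dX H U}
    (halg : ∀ t h, Measurable fun p : History dX H U t × Vec dX => alg t p.1 h p.2)
    {Ω : Type*} [MeasurableSpace Ω] {ε : ℕ → Fin H → Ω → Vec dX} (t : ℕ)
    (hε : ∀ s ≤ t, ∀ h, Measurable (ε s h)) :
    Measurable fun ω => runTraj φ W x0 alg (fun s h => ε s h ω) t := by
  induction t using Nat.strong_induction_on with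
  | _ t ih =>
    have heq : (fun ω => runTraj φ W x0 alg (fun s h => ε s h ω) t) = fun ω =>
        rollout φ W x0 (alg t fun i : Fin t => runTraj φ W x0 alg (fun s h => ε s h ω) i)
          fun h => ε t h ω := funext fun ω => by rw [runTraj]
    have hh : Measurable fun ω => fun i : Fin t => runTraj φ W x0 alg (fun s h => ε s h ω) i :=
      measurable_pi_lambda _ fun i => ih i i.isLt fun s hs => hε s (hs.trans i.isLt.le)
    rw [heq]
    exact measurable_rollout hφ W x0 (Measurable.alg_comp halg hh)
      (measurable_pi_lambda _ fun h => hε t le_rfl h)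

lemma measurable_runHist {φ : Vec dX → U → Vec dφ} (hφ : Measurable (Function.uncurry φ))
    (W : Param dX dφ) (x0 : Vec dX) {alg : Algorithm dX H U}
    (halg : ∀ t h, Measurable fun p : History dX H U t × Vec dX => alg t p.1 h p.2)
    {Ω : Type*} [MeasurableSpace Ω] {ε : ℕ → Fin H → Ω → Vec dX} (t : ℕ)
    (hε : ∀ s < t, ∀ h, Measurable (ε s h)) :
    Measurable fun ω => runHist φ W x0 alg (fun s h => ε s h ω) t :=
  measurable_pi_lambda _ fun i => measurable_runTraj hφ W x0 halg i fun s hs =>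
    hε s (lt_of_le_of_lt hs i.isLt)

variable {Ω : Type*} [MeasurableSpace Ω] {P : Measure Ω} {σ : ℝ} {ε : ℕ → Fin H → Ω → Vec dX}

lemma map_episode_noise [IsProbabilityMeasure P] (hε : ∀ t h, Measurable (ε t h))
    (hlaw : ∀ t h, P.map (ε t h) = gaussianNoise dX σ)
    (hind : iIndepFun (fun p : ℕ × Fin H => ε p.1 p.2) P) (t : ℕ) :
    P.map (fun ω h => ε t h ω) = Measure.pi fun _ => gaussianNoise dX σ := by
  have h1 : iIndepFun (fun h : Fin H => ε t h) P :=
    hind.precomp (g := fun h : Fin H => (t, h)) fun a b hab => (Prod.ext_iff.1 hab).2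
  rw [(iIndepFun_iff_map_fun_eq_pi_map fun h => (hε t h).aemeasurable).1 h1]
  simp_rw [hlaw]

/-- The two sides are measurable for the σ-algebras generated by disjoint blocks of the noise, `s <
t` and `s = t`. -/
lemma indepFun_runHist {φ : Vec dX → U → Vec dφ} (hφ : Measurable (Function.uncurry φ))
    (W : Param dX dφ) (x0 : Vec dX) {alg : Algorithm dX H U}
    (halg : ∀ t h, Measurable fun p : History dX H U t × Vec dX => alg t p.1 h p.2)
    (hε : ∀ t h, Measurable (ε t h))
    (hind : iIndepFun (fun p : ℕ × Fin H => ε p.1 p.2) P) (t : ℕ) :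
    IndepFun (fun ω => runHist φ W x0 alg (fun s h => ε s h ω) t) (fun ω h => ε t h ω) P := by
  let m : ℕ × Fin H → MeasurableSpace Ω := fun p => MeasurableSpace.comap (ε p.1 p.2) inferInstance
  have hm : ∀ p, m p ≤ ‹MeasurableSpace Ω› := fun p => (hε p.1 p.2).comap_le
  have hdisj : Disjoint {p : ℕ × Fin H | p.1 < t} {p | p.1 = t} :=
    Set.disjoint_left.2 fun p hp hp' => (ne_of_lt hp) hp'
  have h := indep_iSup_of_disjoint hm hind.iIndep hdisj
  have hle : ∀ {S : Set (ℕ × Fin H)} {p}, p ∈ S → Measurable[⨆ i ∈ S, m i] (ε p.1 p.2) := by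
    intro S p hp
    exact (comap_measurable (ε p.1 p.2)).mono (le_iSup₂_of_le p hp le_rfl) le_rfl
  refine indep_of_indep_of_le_left (indep_of_indep_of_le_right h ?_) ?_
  · refine Measurable.comap_le ?_
    refine @measurable_pi_lambda _ _ _ (⨆ i ∈ {p : ℕ × Fin H | p.1 = t}, m i) _ _ fun h => ?_
    exact hle (p := (t, h)) rfl
  · refine Measurable.comap_le ?_
    refine @measurable_runHist _ _ _ _ _ _ hφ W x0 _ halg _
      (⨆ i ∈ {p : ℕ × Fin H | p.1 < t}, m i) _ t fun s hs h => ?_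
    exact hle (p := (s, h)) hs

variable [IsProbabilityMeasure P]

/-- Conditioning the trajectory of episode `t` on the history. -/
lemma lintegral_runTraj {φ : Vec dX → U → Vec dφ} (hφ : Measurable (Function.uncurry φ))
    (W : Param dX dφ) (x0 : Vec dX) {alg : Algorithm dX H U}
    (halg : ∀ t h, Measurable fun p : History dX H U t × Vec dX => alg t p.1 h p.2)
    (hε : ∀ t h, Measurable (ε t h)) (hlaw : ∀ t h, P.map (ε t h) = gaussianNoise dX σ)
    (hind : iIndepFun (fun p : ℕ × Fin H => ε p.1 p.2) P) (t : ℕ)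
    {G : History dX H U t × Traj dX H U → ℝ≥0∞} (hG : Measurable G) :
    ∫⁻ ω, G (runHist φ W x0 alg (fun s h => ε s h ω) t,
        runTraj φ W x0 alg (fun s h => ε s h ω) t) ∂P =
      ∫⁻ ω, ∫⁻ e, G (runHist φ W x0 alg (fun s h => ε s h ω) t,
        rollout φ W x0 (alg t (runHist φ W x0 alg (fun s h => ε s h ω) t)) e)
        ∂Measure.pi (fun _ => gaussianNoise dX σ) ∂P := by
  have hh := measurable_runHist hφ W x0 halg t fun s _ h => hε s h
  have he : Measurable fun ω h => ε t h ω := measurable_pi_lambda _ fun h => hε t h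
  have hF : Measurable fun p : History dX H U t × (Fin H → Vec dX) =>
      G (p.1, rollout φ W x0 (alg t p.1) p.2) :=
    hG.comp (measurable_fst.prodMk (measurable_rollout hφ W x0
      (Measurable.alg_comp halg measurable_fst) measurable_snd))
  have h1 := (indepFun_iff_map_prod_eq_prod_map_map hh.aemeasurable he.aemeasurable).1
    (indepFun_runHist hφ W x0 halg hε hind t)
  rw [map_episode_noise hε hlaw hind t] at h1
  have h2 := lintegral_map (μ := P) hF (hh.prodMk he)
  rw [h1, lintegral_prod _ hF.aemeasurable, lintegral_map hF.lintegral_prod_right' hh] at h2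
  rw [h2]
  refine lintegral_congr fun ω => ?_
  conv_lhs => rw [runTraj]
  rfl

lemma measurable_lintegral_rollout {φ : Vec dX → U → Vec dφ} (hφ : Measurable (Function.uncurry φ))
    (W : Param dX dφ) (x0 : Vec dX) {alg : Algorithm dX H U}
    (halg : ∀ t h, Measurable fun p : History dX H U t × Vec dX => alg t p.1 h p.2)
    (t : ℕ) {G : History dX H U t × Traj dX H U → ℝ≥0∞} (hG : Measurable G) :
    Measurable fun hist : History dX H U t => ∫⁻ e, G (hist, rollout φ W x0 (alg t hist) e)
        ∂Measure.pi (fun _ => gaussianNoise dX σ) :=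
  Measurable.lintegral_prod_right' (f := fun p : History dX H U t × (Fin H → Vec dX) =>
      G (p.1, rollout φ W x0 (alg t p.1) p.2))
    (hG.comp (measurable_fst.prodMk (measurable_rollout hφ W x0
      (Measurable.alg_comp halg measurable_fst) measurable_snd)))

lemma measurable_featureCov {φ : Vec dX → U → Vec dφ} (hφ : Measurable (Function.uncurry φ))
    (lam : ℝ) {t : ℕ} (i j : Fin dφ) :
    Measurable fun hist : History dX H U t => featureCov φ lam hist i j := by
  simp only [featureCov_eq, Matrix.add_apply, Matrix.sum_apply, vecMulVec_apply]
  refine measurable_const.add (Finset.measurable_sum _ fun p _ => ?_)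
  exact (Measurable.feat_apply hφ (measurable_pi_apply p.1) p.2 i).mul
    (Measurable.feat_apply hφ (measurable_pi_apply p.1) p.2 j)

lemma measurable_trajNoise {φ : Vec dX → U → Vec dφ} (hφ : Measurable (Function.uncurry φ))
    (W : Param dX dφ) (v : Vec dX) (i : Fin dφ) :
    Measurable fun τ : Traj dX H U => trajNoise φ W v τ i := by
  simp only [trajNoise, Finset.sum_apply, Pi.smul_apply, smul_eq_mul]
  refine Finset.measurable_sum _ fun h _ => ?_
  have hf := measurable_feat (H := H) hφ h
  have h1 : Measurable fun τ : Traj dX H U => Matrix.toEuclideanLin W (feat φ τ h) :=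
    (LinearMap.toContinuousLinearMap (Matrix.toEuclideanLin W)).measurable.comp hf
  refine Measurable.mul (measurable_const.inner (Measurable.sub (by fun_prop) h1)) (by fun_prop)

lemma measurable_histNoise {φ : Vec dX → U → Vec dφ} (hφ : Measurable (Function.uncurry φ))
    (W : Param dX dφ) (v : Vec dX) {t : ℕ} (i : Fin dφ) :
    Measurable fun hist : History dX H U t => histNoise φ W v hist i := by
  simp only [histNoise, Finset.sum_apply]
  exact Finset.measurable_sum _ fun k _ =>
    (measurable_trajNoise hφ W v i).comp (measurable_pi_apply k)

lemma measurable_noiseStat {φ : Vec dX → U → Vec dφ} (hφ : Measurable (Function.uncurry φ))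
    (lam σ : ℝ) (W : Param dX dφ) (N : Finset (Vec dX)) {t : ℕ} :
    Measurable fun hist : History dX H U t => noiseStat φ lam σ W N hist :=
  Finset.measurable_sum _ fun v _ => Measurable.selfNorm (measurable_featureCov hφ lam)
    (measurable_histNoise hφ W v)

lemma measurable_beta {φ : Vec dX → U → Vec dφ} (hφ : Measurable (Function.uncurry φ))
    (C₁ lam σ w : ℝ) {t : ℕ} :
    Measurable fun hist : History dX H U t => beta φ C₁ lam σ w hist := by
  have := Measurable.matrix_det (measurable_featureCov (H := H) (t := t) hφ lam)
  unfold beta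
  fun_prop

lemma measurable_width {φ : Vec dX → U → Vec dφ} (hφ : Measurable (Function.uncurry φ))
    (lam σ w : ℝ) {t : ℕ} :
    Measurable fun p : History dX H U t × Traj dX H U => width φ lam σ w p.1 p.2 := by
  have h1 := measurable_beta (H := H) (t := t) hφ 20 lam σ w
  have h2 : ∀ h : Fin H, Measurable fun p : History dX H U t × Traj dX H U =>
      invQuad (featureCov φ lam p.1) (feat φ p.2 h).ofLp := fun h => Measurable.invQuad
    (fun i j => (measurable_featureCov hφ lam i j).comp measurable_fst) fun i =>
      Measurable.feat_apply hφ measurable_snd h i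
  unfold width trajQuad
  fun_prop

/-- The self-normalized likelihood ratio is a martingale over the episodes. -/
lemma lintegral_selfNorm_runHist {φ : Vec dX → U → Vec dφ} (hφ : Measurable (Function.uncurry φ))
    (hσ : 0 < σ) {lam : ℝ} (hlam : 0 < lam) (W : Param dX dφ) (x0 : Vec dX)
    {alg : Algorithm dX H U}
    (halg : ∀ t h, Measurable fun p : History dX H U t × Vec dX => alg t p.1 h p.2)
    (hε : ∀ t h, Measurable (ε t h)) (hlaw : ∀ t h, P.map (ε t h) = gaussianNoise dX σ)
    (hind : iIndepFun (fun p : ℕ × Fin H => ε p.1 p.2) P) {v : Vec dX} (hv : ‖v‖ = 1) (t : ℕ) :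
    ∫⁻ ω, selfNorm σ (featureCov φ lam (runHist φ W x0 alg (fun s h => ε s h ω) t))
      (histNoise φ W v (runHist φ W x0 alg (fun s h => ε s h ω) t)) ∂P =
      selfNorm σ (lam • (1 : Matrix (Fin dφ) (Fin dφ) ℝ)) 0 := by
  induction t with
  | zero => simp [featureCov, histNoise]
  | succ t ih =>
    rw [← ih]
    have hG : Measurable fun p : History dX H U t × Traj dX H U =>
        selfNorm σ (featureCov φ lam p.1 +
            ∑ h, vecMulVec (feat φ p.2 h).ofLp (feat φ p.2 h).ofLp)
          (histNoise φ W v p.1 + trajNoise φ W v p.2) := by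
      refine Measurable.selfNorm (fun i j => ?_) fun i => ?_
      · simp only [Matrix.add_apply, Matrix.sum_apply, vecMulVec_apply]
        refine ((measurable_featureCov hφ lam i j).comp measurable_fst).add
          (Finset.measurable_sum _ fun h _ => ?_)
        exact (Measurable.feat_apply hφ measurable_snd h i).mul
          (Measurable.feat_apply hφ measurable_snd h j)
      · exact ((measurable_histNoise hφ W v i).comp measurable_fst).add
          ((measurable_trajNoise hφ W v i).comp measurable_snd)
    have h1 : ∀ ω, selfNorm σ
        (featureCov φ lam (runHist φ W x0 alg (fun s h => ε s h ω) (t + 1)))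
        (histNoise φ W v (runHist φ W x0 alg (fun s h => ε s h ω) (t + 1))) =
        selfNorm σ (featureCov φ lam (runHist φ W x0 alg (fun s h => ε s h ω) t) +
            ∑ h, vecMulVec (feat φ (runTraj φ W x0 alg (fun s h => ε s h ω) t) h).ofLp
              (feat φ (runTraj φ W x0 alg (fun s h => ε s h ω) t) h).ofLp)
          (histNoise φ W v (runHist φ W x0 alg (fun s h => ε s h ω) t) +
            trajNoise φ W v (runTraj φ W x0 alg (fun s h => ε s h ω) t)) := by
      intro ω
      have h2 := featureCov_succ φ lam (runTraj φ W x0 alg (fun s h => ε s h ω)) t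
      have h3 : histNoise φ W v (runHist φ W x0 alg (fun s h => ε s h ω) (t + 1)) =
          histNoise φ W v (runHist φ W x0 alg (fun s h => ε s h ω) t) +
            trajNoise φ W v (runTraj φ W x0 alg (fun s h => ε s h ω) t) := by
        rw [histNoise, Fin.sum_univ_castSucc]
        rfl
      rw [h3]
      congr 1
    simp_rw [h1]
    -- Given the history the policy of the episode is fixed, so the identity for a single rollout
    -- applies.
    rw [lintegral_runTraj hφ W x0 halg hε hlaw hind t hG]
    refine lintegral_congr fun ω => ?_
    set hist := runHist φ W x0 alg (fun s h => ε s h ω) t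
    have hπ : ∀ h, Measurable (alg t hist h) := fun h => (halg t h).comp measurable_prodMk_left
    have h4 := lintegral_selfNorm_predictable hσ (posDef_featureCov φ hlam hist)
      (histNoise φ W v hist) hv (f := fun h e => (feat φ (rollout φ W x0 (alg t hist) e) h).ofLp)
      (fun k j hkj ε e => by
        simp only [predictable_feat φ W x0 (alg t hist) k j hkj ε e])
      (fun k => by
        have := measurable_feat_rollout hφ W x0 hπ k
        fun_prop)
    rw [← h4]
    refine lintegral_congr fun e => ?_
    have h5 : trajNoise φ W v (rollout φ W x0 (alg t hist) e) =
        ∑ h, ⟪v, e h⟫ • (feat φ (rollout φ W x0 (alg t hist) e) h).ofLp := by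
      refine Finset.sum_congr rfl fun h _ => ?_
      congr 2
      simp only [rollout, feat, Fin.val_succ, Fin.val_castSucc, state_succ]
      abel
    simp only [h5]

/-- The noise statistic exceeds `4t` times its mean bound with probability at most `1/(4t)`. -/
lemma measure_noiseStat_ge_le {φ : Vec dX → U → Vec dφ} (hφ : Measurable (Function.uncurry φ))
    (hσ : 0 < σ) {lam : ℝ} (hlam : 0 < lam) (W : Param dX dφ) (x0 : Vec dX)
    {alg : Algorithm dX H U}
    (halg : ∀ t h, Measurable fun p : History dX H U t × Vec dX => alg t p.1 h p.2)
    (hε : ∀ t h, Measurable (ε t h)) (hlaw : ∀ t h, P.map (ε t h) = gaussianNoise dX σ)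
    (hind : iIndepFun (fun p : ℕ × Fin H => ε p.1 p.2) P) {N : Finset (Vec dX)}
    (hN : ∀ v ∈ N, ‖v‖ = 1) (hNc : N.card ≤ 5 ^ dX) {t : ℕ} (ht : t ≠ 0) :
    P {ω | ENNReal.ofReal (5 ^ dX * (4 * t)) *
        selfNorm σ (lam • (1 : Matrix (Fin dφ) (Fin dφ) ℝ)) 0 ≤
        noiseStat φ lam σ W N (runHist φ W x0 alg (fun s h => ε s h ω) t)} ≤
      ENNReal.ofReal (1 / (4 * t)) := by
  have hh := measurable_runHist hφ W x0 halg t fun s _ h => hε s h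
  have ht0 : (0 : ℝ) < t := by exact_mod_cast Nat.pos_of_ne_zero ht
  have hd0 := (posDef_smul_one (n := Fin dφ) hlam).det_pos
  set c := selfNorm σ (lam • (1 : Matrix (Fin dφ) (Fin dφ) ℝ)) 0 with hc
  have hc0 : c ≠ 0 := by
    rw [hc, selfNorm]
    exact (ENNReal.ofReal_pos.2 (div_pos (Real.exp_pos _) (Real.sqrt_pos.2 hd0))).ne'
  have hct : c ≠ ∞ := ENNReal.ofReal_ne_top
  have hE : ∫⁻ ω, noiseStat φ lam σ W N (runHist φ W x0 alg (fun s h => ε s h ω) t) ∂P ≤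
      ENNReal.ofReal (5 ^ dX) * c := by
    unfold noiseStat
    have hm : ∀ v : Vec dX, Measurable fun ω =>
        selfNorm σ (featureCov φ lam (runHist φ W x0 alg (fun s h => ε s h ω) t))
          (histNoise φ W v (runHist φ W x0 alg (fun s h => ε s h ω) t)) := fun v =>
      Measurable.selfNorm (fun i j => (measurable_featureCov hφ lam i j).comp hh)
        fun i => (measurable_histNoise hφ W v i).comp hh
    rw [lintegral_finsetSum _ fun v _ => hm v,
      Finset.sum_congr rfl fun v hv =>
      lintegral_selfNorm_runHist hφ hσ hlam W x0 halg hε hlaw hind (hN v hv) t,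
      Finset.sum_const, nsmul_eq_mul]
    refine mul_le_mul_left ?_ _
    rw [ENNReal.ofReal_pow (by norm_num)]
    have : ((N.card : ℕ) : ℝ≥0∞) ≤ ((5 ^ dX : ℕ) : ℝ≥0∞) := by exact_mod_cast hNc
    simpa using this
  -- Markov's inequality for the sum over the net, whose mean is at most `5^dX` times the initial
  -- value, in place of a union bound.
  refine (meas_ge_le_lintegral_div (((measurable_noiseStat hφ lam σ W N).comp hh).aemeasurable)
    (mul_ne_zero (ENNReal.ofReal_pos.2 (by positivity)).ne' hc0)
    (ENNReal.mul_ne_top ENNReal.ofReal_ne_top hct)).trans ?_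
  refine ENNReal.div_le_of_le_mul (hE.trans_eq ?_)
  rw [← mul_assoc, ← ENNReal.ofReal_mul (by positivity)]
  congr 2
  field_simp

end Interaction
end LC3

namespace LC3

/-! ### The excess cost of a single episode. -/

section Episode

variable {dX dφ H : ℕ} {U : Type*}

/-- The optimistic policy has nearly optimal cost if the ball contains the true parameter. -/
lemma J_le_Jstar_add {φ : Vec dX → U → Vec dφ} {σ : ℝ} {x0 : Vec dX} {c : Vec dX → U → ℝ≥0}
    {W : Param dX dφ} {Pol : Set (Policy dX H U)} {Bl : Set (Param dX dφ)} {π : Policy dX H U}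
    (hopt : IsOptimistic φ σ x0 c Pol Bl π) (hW : W ∈ Bl) {X : ℝ≥0∞}
    (hX : ∀ W' ∈ Bl, J φ σ x0 c W π ≤ J φ σ x0 c W' π + X) :
    J φ σ x0 c W π ≤ Jstar φ σ x0 c W Pol + X := by
  rw [← tsub_le_iff_right]
  refine (le_iInf₂ fun W' hW' => tsub_le_iff_right.2 (hX W' hW') :
    _ ≤ ⨅ W' ∈ Bl, J φ σ x0 c W' π).trans ?_
  exact le_iInf₂ fun π' hπ' => (hopt.2 π' hπ').trans (iInf₂_le W hW)

/-- The bound does not involve `W'`, hence survives the infimum over the ball. -/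
lemma sum_sq_le_width {φ : Vec dX → U → Vec dφ} {lam σ w : ℝ} (hlam : 0 < lam)
    {Ball₀ : Set (Param dX dφ)} {t : ℕ} (ht : t ≠ 0) {hist : History dX H U t}
    {W W' : Param dX dφ} (hW : W ∈ ball φ 20 lam σ w Ball₀ hist)
    (hW' : W' ∈ ball φ 20 lam σ w Ball₀ hist) (τ : Traj dX H U) :
    min (∑ h, ‖Matrix.toEuclideanLin (W - W') (feat φ τ h)‖ ^ 2 / σ ^ 2) 1 ≤
      width φ lam σ w hist τ := by
  refine min_le_min ?_ le_rfl
  rw [trajQuad, Finset.mul_sum]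
  refine Finset.sum_le_sum fun h _ => ?_
  have := norm_sub_sq_le_of_mem_ball φ hlam ht hW hW' (feat φ τ h)
  rw [div_mul_eq_mul_div]
  exact div_le_div_of_nonneg_right this (sq_nonneg σ)

variable [MeasurableSpace U]

/-- Cauchy–Schwarz against the constant `1`. It is the fallback for episode `0` and for failures of
the confidence ball, and it gives integrability. -/
lemma J_le_sqrt {φ : Vec dX → U → Vec dφ} (hφ : Measurable (Function.uncurry φ)) {σ : ℝ}
    (x0 : Vec dX) {c : Vec dX → U → ℝ≥0} (hc : Measurable (Function.uncurry c))
    (W : Param dX dφ) {π : Policy dX H U} (hπ : ∀ h, Measurable (π h)) {V : ℝ≥0}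
    (hV : secondMoment φ σ x0 c W π ≤ V) : J φ σ x0 c W π ≤ ENNReal.ofReal √V := by
  have hm : Measurable fun ε => (cumCost c (rollout φ W x0 π ε) : ℝ≥0∞) :=
    ((measurable_cumCost hc).comp (measurable_rollout hφ W x0 (π := fun _ => π)
      (fun h => (hπ h).comp measurable_snd) measurable_id)).coe_nnreal_ennreal
  have h := ENNReal.lintegral_mul_le_Lp_mul_Lq (Measure.pi fun _ : Fin H => gaussianNoise dX σ)
    Real.HolderConjugate.two_two hm.aemeasurable (aemeasurable_const (b := (1 : ℝ≥0∞)))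
  simp only [Pi.mul_apply, mul_one, one_pow, ENNReal.one_rpow, lintegral_const, measure_univ,
    ENNReal.rpow_two] at h
  refine h.trans ((ENNReal.rpow_le_rpow hV (by norm_num)).trans_eq ?_)
  rw [Real.sqrt_eq_rpow, ← ENNReal.ofReal_rpow_of_nonneg V.coe_nonneg (by norm_num),
    ENNReal.ofReal_coe_nnreal]

variable {Ω : Type*} [MeasurableSpace Ω] {P : Measure Ω} [IsProbabilityMeasure P] {σ : ℝ}
  {ε : ℕ → Fin H → Ω → Vec dX}

lemma lintegral_cumCost_le_sqrt {φ : Vec dX → U → Vec dφ} (hφ : Measurable (Function.uncurry φ))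
    (W : Param dX dφ) (x0 : Vec dX) {Pol : Set (Policy dX H U)}
    (hPol : ∀ π ∈ Pol, ∀ h, Measurable (π h)) {c : Vec dX → U → ℝ≥0}
    (hc : Measurable (Function.uncurry c)) {V : ℝ≥0}
    (hV : ∀ π ∈ Pol, secondMoment φ σ x0 c W π ≤ V) {alg : Algorithm dX H U}
    (halg : ∀ t h, Measurable fun p : History dX H U t × Vec dX => alg t p.1 h p.2)
    (hε : ∀ t h, Measurable (ε t h)) (hlaw : ∀ t h, P.map (ε t h) = gaussianNoise dX σ)
    (hind : iIndepFun (fun p : ℕ × Fin H => ε p.1 p.2) P) (t : ℕ)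
    (hmem : ∀ᵐ ω ∂P, alg t (runHist φ W x0 alg (fun s h => ε s h ω) t) ∈ Pol) :
    ∫⁻ ω, (cumCost c (runTraj φ W x0 alg (fun s h => ε s h ω) t) : ℝ≥0∞) ∂P ≤
      ENNReal.ofReal √V := by
  rw [lintegral_runTraj hφ W x0 halg hε hlaw hind t
    (G := fun p => (cumCost c p.2 : ℝ≥0∞))
    ((measurable_cumCost hc).comp measurable_snd).coe_nnreal_ennreal]
  refine (lintegral_mono_ae (hmem.mono fun ω hω => ?_)).trans_eq
    ((lintegral_const (ENNReal.ofReal √V)).trans (by simp))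
  exact J_le_sqrt hφ x0 hc W (hPol _ hω) (hV _ hω)

/-- The expected cost of an episode `t ≥ 1` compared with the best policy. -/
lemma lintegral_cumCost_le {φ : Vec dX → U → Vec dφ} (hφ : Measurable (Function.uncurry φ))
    (hσ : 0 < σ) {lam : ℝ} (hlam : 0 < lam) {W : Param dX dφ}
    (hw : lam * specNorm W ^ 2 = σ ^ 2) (x0 : Vec dX) {Pol : Set (Policy dX H U)}
    (hPol : ∀ π ∈ Pol, ∀ h, Measurable (π h)) {c : Vec dX → U → ℝ≥0}
    (hc : Measurable (Function.uncurry c)) {V : ℝ≥0}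
    (hV : ∀ π ∈ Pol, secondMoment φ σ x0 c W π ≤ V) {alg : Algorithm dX H U}
    (halg : ∀ t h, Measurable fun p : History dX H U t × Vec dX => alg t p.1 h p.2)
    (hε : ∀ t h, Measurable (ε t h)) (hlaw : ∀ t h, P.map (ε t h) = gaussianNoise dX σ)
    (hind : iIndepFun (fun p : ℕ × Fin H => ε p.1 p.2) P) {Ball₀ : Set (Param dX dφ)} {t : ℕ}
    (ht : t ≠ 0)
    (hopt : ∀ᵐ ω ∂P, IsOptimistic φ σ x0 c Pol
      (ball φ 20 lam σ (specNorm W) Ball₀ (runHist φ W x0 alg (fun s h => ε s h ω) t))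
      (alg t (runHist φ W x0 alg (fun s h => ε s h ω) t))) {a : ℝ} (ha : 0 < a) :
    ∫⁻ ω, (cumCost c (runTraj φ W x0 alg (fun s h => ε s h ω) t) : ℝ≥0∞) ∂P ≤
      Jstar φ σ x0 c W Pol + ENNReal.ofReal (V / (2 * a)) +
      ENNReal.ofReal a * ∫⁻ ω, ENNReal.ofReal (width φ lam σ (specNorm W)
        (runHist φ W x0 alg (fun s h => ε s h ω) t)
        (runTraj φ W x0 alg (fun s h => ε s h ω) t)) ∂P +
      ENNReal.ofReal √V * ENNReal.ofReal (1 / (4 * t)) := by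
  obtain ⟨N, hN1, hN2, hN3⟩ := exists_half_net dX
  have hh := measurable_runHist hφ W x0 halg t fun s _ h => hε s h
  have hwm := (measurable_width (H := H) (t := t) hφ lam σ (specNorm W)).ennreal_ofReal
  set fail := {ω | ENNReal.ofReal (5 ^ dX * (4 * t)) *
        selfNorm σ (lam • (1 : Matrix (Fin dφ) (Fin dφ) ℝ)) 0 ≤
        noiseStat φ lam σ W N (runHist φ W x0 alg (fun s h => ε s h ω) t)} with hfail
  have hfm : MeasurableSet fail :=
    measurableSet_le measurable_const ((measurable_noiseStat hφ lam σ W N).comp hh)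
  have hfP : P fail ≤ ENNReal.ofReal (1 / (4 * t)) :=
    measure_noiseStat_ge_le hφ hσ hlam W x0 halg hε hlaw hind hN1 hN2 ht
  set D : Ω → ℝ≥0∞ := fun ω => ∫⁻ e, ENNReal.ofReal (width φ lam σ (specNorm W)
      (runHist φ W x0 alg (fun s h => ε s h ω) t)
      (rollout φ W x0 (alg t (runHist φ W x0 alg (fun s h => ε s h ω) t)) e))
      ∂Measure.pi (fun _ : Fin H => gaussianNoise dX σ) with hD
  have hDm : Measurable D := (measurable_lintegral_rollout hφ W x0 halg t hwm).comp hh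
  -- The case split depends on the history alone, so it is made before the expectation over the
  -- noise of episode `t` is bounded.
  have hpt : ∀ᵐ ω ∂P, J φ σ x0 c W (alg t (runHist φ W x0 alg (fun s h => ε s h ω) t)) ≤
      (Jstar φ σ x0 c W Pol + ENNReal.ofReal (V / (2 * a))) + (ENNReal.ofReal a * D ω +
        fail.indicator (fun _ => ENNReal.ofReal √V) ω) := by
    filter_upwards [hopt] with ω hω
    by_cases hf : ω ∈ fail
    · rw [Set.indicator_of_mem hf]
      refine (J_le_sqrt hφ x0 hc W (hPol _ hω.1) (hV _ hω.1)).trans ?_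
      exact le_add_self.trans le_add_self
    · rw [Set.indicator_of_notMem hf, add_zero]
      have hW : W ∈ ball φ 20 lam σ (specNorm W) Ball₀
          (runHist φ W x0 alg (fun s h => ε s h ω) t) :=
        mem_ball_of_noiseStat_lt φ hσ hlam ht hw hN3 (not_le.1 hf)
      rw [add_assoc]
      refine J_le_Jstar_add hω hW fun W' hW' => ?_
      refine (J_le_of_params hφ hσ x0 hc W W' (hPol _ hω.1) (hV _ hω.1) ha).trans ?_
      rw [add_assoc]
      refine add_le_add le_rfl (add_le_add le_rfl (mul_le_mul_right ?_ _))
      exact lintegral_mono fun e =>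
        ENNReal.ofReal_le_ofReal (sum_sq_le_width hlam ht hW hW' _)
  rw [lintegral_runTraj hφ W x0 halg hε hlaw hind t
    (G := fun p => (cumCost c p.2 : ℝ≥0∞))
    ((measurable_cumCost hc).comp measurable_snd).coe_nnreal_ennreal,
    lintegral_runTraj hφ W x0 halg hε hlaw hind t hwm]
  refine (lintegral_mono_ae hpt).trans ?_
  rw [lintegral_add_left measurable_const, lintegral_add_left (hDm.const_mul _),
    lintegral_const_mul _ hDm, lintegral_indicator_const hfm, lintegral_const, measure_univ,
    mul_one, ← add_assoc]
  exact add_le_add le_rfl (mul_le_mul_right hfP _)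

end Episode

/-! ### Summation over episodes, choice of `a`, and constants. -/

section Final

/-- The harmonic sum is bounded crudely, by induction from `(√T + 1/(4T))² ≤ T + 1`; this matches
the rate of the main term. -/
lemma sum_inv_four_mul_le_sqrt (T : ℕ) :
    ∑ t ∈ (Finset.range T).erase 0, 1 / (4 * (t : ℝ)) ≤ √T := by
  induction T with
  | zero => simp
  | succ T ih =>
    rcases Nat.eq_zero_or_pos T with rfl | hT
    · simp
    · rw [Finset.range_add_one, Finset.erase_insert_of_ne hT.ne', Finset.sum_insert (by simp)]
      have hT1 : (1 : ℝ) ≤ T := by exact_mod_cast hT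
      have h1 : √(T : ℝ) ≤ T := by
        rw [Real.sqrt_le_left (by linarith)]; nlinarith
      have h2 : √(T : ℝ) + 1 / (4 * T) ≤ √((T + 1 : ℕ) : ℝ) := by
        refine Real.le_sqrt_of_sq_le ?_
        push_cast
        have h3 : (1 / (4 * (T : ℝ))) ≤ 1 / 4 :=
          one_div_le_one_div_of_le (by norm_num) (by linarith)
        have h4 : T * (1 / (4 * (T : ℝ))) = 1 / 4 := by field_simp
        have h5 : 0 ≤ 1 / (4 * (T : ℝ)) := by positivity
        have h6 := Real.sq_sqrt (show (0 : ℝ) ≤ T by linarith)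
        have h7 := mul_le_mul_of_nonneg_right h1 h5
        nlinarith
      linarith

lemma le_two_mul_sqrt_of_forall {R Y K : ℝ} (hY : 0 ≤ Y) (hK : 0 < K)
    (h : ∀ a > 0, R ≤ Y / a + a * K) : R ≤ 2 * √(Y * K) := by
  rcases hY.eq_or_lt with rfl | hY
  -- For `Y = 0` the optimal `a` degenerates to `0`; if `R > 0`, then `a = R/(2K)` gives the
  -- contradiction `R ≤ R/2`.
  · rw [zero_mul, Real.sqrt_zero, mul_zero]
    by_contra hR
    have := h (R / (2 * K)) (by push Not at hR; positivity)
    rw [zero_div, zero_add, div_mul_eq_mul_div, mul_div_mul_right _ _ hK.ne'] at this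
    linarith
  · have h1 := h (√(Y / K)) (by positivity)
    refine h1.trans_eq ?_
    rw [Real.sqrt_div hY.le, Real.sqrt_mul hY.le]
    have h2 := Real.mul_self_sqrt hY.le
    have h3 := Real.mul_self_sqrt hK.le
    have h4 := Real.sqrt_pos.2 hY
    have h5 := Real.sqrt_pos.2 hK
    field_simp
    nlinarith

/-- In `hR` the first `√V` is episode `0` and `√V √T` the failures. Choosing `a` gives `2√(80 ⋯) ≤
18√⋯`, and the two fallback terms add at most `2√(V T)`: together `20`. Of `h` only `h ≥ 1` enters.
-/
lemma regret_arith {R V d x l h T L : ℝ} (hV : 0 ≤ V) (hd : 1 ≤ d) (hx : 0 ≤ x) (hl : 0 ≤ l)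
    (hh : 1 ≤ h) (hT : 1 ≤ T) (hL : 0 ≤ L)
    (hR : ∀ a > 0, R ≤ √V + (T * (V / (2 * a)) + a * (160 * (1 + x + l + d * L) * (d * L)) +
      √V * √T)) :
    R ≤ 20 * √(d * (d + x + l + h) * V * h * T) * max 1 L := by
  set m := max 1 L with hm
  have hm1 : 1 ≤ m := le_max_left _ _
  have hLm : L ≤ m := le_max_right _ _
  set D := d * (d + x + l + h) with hD
  have hD1 : 1 ≤ D := by
    have : 1 ≤ d + x + l + h := by linarith
    nlinarith
  have hK : (1 + x + l + d * L) * (d * L) ≤ D * m ^ 2 := by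
    have h1 : 1 + x + l + d * L ≤ m * (d + x + l + h) := by nlinarith
    have h2 : d * L ≤ d * m := mul_le_mul_of_nonneg_left hLm (by linarith)
    calc _ ≤ (m * (d + x + l + h)) * (d * m) :=
          mul_le_mul h1 h2 (by positivity) (by positivity)
      _ = _ := by rw [hD]; ring
  have hVT : √V + √V * √T ≤ 2 * √(V * T) := by
    rw [Real.sqrt_mul hV]
    have : 1 ≤ √T := Real.one_le_sqrt.2 hT
    nlinarith [Real.sqrt_nonneg V]
  have h1 := le_two_mul_sqrt_of_forall (R := R - 2 * √(V * T)) (Y := T * V / 2)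
    (K := 160 * (D * m ^ 2)) (by positivity) (by positivity) fun a ha => by
      have h2 := hR a ha
      have h3 : T * (V / (2 * a)) = T * V / 2 / a := by field_simp
      have h4 := mul_le_mul_of_nonneg_left hK ha.le
      linarith
  have h2 : √(T * V / 2 * (160 * (D * m ^ 2))) ≤ 9 * √(D * V * h * T) * m := by
    rw [show T * V / 2 * (160 * (D * m ^ 2)) = 80 * (D * V * T) * m ^ 2 by ring,
      Real.sqrt_mul (by positivity), Real.sqrt_sq (by linarith)]
    refine mul_le_mul_of_nonneg_right ?_ (by linarith)
    rw [show (9 : ℝ) = √81 by rw [show (81 : ℝ) = 9 ^ 2 by norm_num, Real.sqrt_sq (by norm_num)],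
      ← Real.sqrt_mul (by norm_num)]
    refine Real.sqrt_le_sqrt ?_
    have h5 : 0 ≤ D * V * T := by positivity
    nlinarith
  have h3 : √(V * T) ≤ √(D * V * h * T) * m := by
    have h6 : √(V * T) ≤ √(D * V * h * T) := by
      refine Real.sqrt_le_sqrt ?_
      have h7 : 1 ≤ D * h := by nlinarith
      have h8 : 0 ≤ V * T := by positivity
      nlinarith
    nlinarith [Real.sqrt_nonneg (D * V * h * T)]
  linarith

end Final
end LC3

theorem mainTheorem2 :
    ∃ C₁ C₂ : ℝ, 0 < C₁ ∧ C₁ ≤ 20 ∧ 0 < C₂ ∧ C₂ ≤ 20 ∧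
    ∀ (dX dφ H : ℕ) (U : Type*) [MeasurableSpace U]
      -- the system: features, true parameter, noise level, initial state
      (φ : LC3.Vec dX → U → LC3.Vec dφ) (_hφ : Measurable (Function.uncurry φ))
      (B : ℝ) (_hB : ∀ x u, ‖φ x u‖ ≤ B)
      (Wstar : LC3.Param dX dφ) (_hW : Wstar ≠ 0)
      (σ : ℝ) (_hσ : 0 < σ) (x0 : LC3.Vec dX)
      -- the policy class and the costs
      (Pol : Set (LC3.Policy dX H U)) (_hPol : ∀ π ∈ Pol, ∀ h, Measurable (π h))
      (c : ℕ → LC3.Vec dX → U → ℝ≥0) (_hc : ∀ t, Measurable (Function.uncurry (c t)))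
      -- bounded second moments
      (Vmax : ℝ≥0)
      (_hV : ∀ t, ∀ π ∈ Pol, LC3.secondMoment φ σ x0 (c t) Wstar π ≤ Vmax)
      -- the independent Gaussian noise
      (Ω : Type*) [MeasurableSpace Ω] (P : Measure Ω) [IsProbabilityMeasure P]
      (ε : ℕ → Fin H → Ω → LC3.Vec dX) (_hε : ∀ t h, Measurable (ε t h))
      (_hεlaw : ∀ t h, P.map (ε t h) = LC3.gaussianNoise dX σ)
      (_hεind : iIndepFun (fun p : ℕ × Fin H => ε p.1 p.2) P)
      -- the algorithm, with regularizer `lam`, parameter `C₁` and initial set `Ball₀`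
      (lam : ℝ) (_hlam : lam = σ ^ 2 / LC3.specNorm Wstar ^ 2)
      (Ball₀ : Set (LC3.Param dX dφ)) (_hBall₀ : Wstar ∈ Ball₀)
      (alg : LC3.Algorithm dX H U)
      (_halg : ∀ t h, Measurable fun p : LC3.History dX H U t × LC3.Vec dX => alg t p.1 h p.2)
      (_hopt : ∀ t, ∀ᵐ ω ∂P,
        LC3.IsOptimistic φ σ x0 (c t) Pol
          (LC3.ball φ C₁ lam σ (LC3.specNorm Wstar) Ball₀
            (LC3.runHist φ Wstar x0 alg (fun s h => ε s h ω) t))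
          (alg t (LC3.runHist φ Wstar x0 alg (fun s h => ε s h ω) t)))
      (T : ℕ),
      Integrable (fun ω => LC3.regret φ σ Wstar x0 c Pol alg (fun s h => ε s h ω) T) P ∧
      ∫ ω, LC3.regret φ σ Wstar x0 c Pol alg (fun s h => ε s h ω) T ∂P ≤
        C₂ * √((dφ : ℝ) * (dφ + dX + Real.log T + H) * Vmax * H * T) *
          max 1 (Real.log (1 + B ^ 2 * LC3.specNorm Wstar ^ 2 / σ ^ 2 * (T * H / dφ))) := by
  refine ⟨20, 20, by norm_num, le_rfl, by norm_num, le_rfl, ?_⟩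
  intro dX dφ H U _ φ hφ B hB W hW σ hσ x0 Pol hPol c hc V hV Ω _ P _ ε hε hlaw hind lam hlam
    Ball₀ _ alg halg hopt T
  have hw0 := LC3.specNorm_pos hW
  have hlam0 : 0 < lam := by rw [hlam]; positivity
  -- This choice of `lam` makes the regularisation bias equal to `σ²`, the unit of all other terms
  -- of `β^t`.
  have hw : lam * LC3.specNorm W ^ 2 = σ ^ 2 := by rw [hlam]; field_simp
  have hsqrt : ∀ t, ∫⁻ ω, (LC3.cumCost (c t)
      (LC3.runTraj φ W x0 alg (fun s h => ε s h ω) t) : ℝ≥0∞) ∂P ≤ ENNReal.ofReal √V := fun t =>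
    LC3.lintegral_cumCost_le_sqrt hφ W x0 hPol (hc t) (hV t) halg hε hlaw hind t
      ((hopt t).mono fun ω hω => hω.1)
  have hcm : ∀ t, Measurable fun ω => LC3.cumCost (c t)
      (LC3.runTraj φ W x0 alg (fun s h => ε s h ω) t) := fun t =>
    (LC3.measurable_cumCost (hc t)).comp
      (LC3.measurable_runTraj hφ W x0 halg t fun s _ h => hε s h)
  have hint : ∀ t, Integrable (fun ω => (LC3.cumCost (c t)
      (LC3.runTraj φ W x0 alg (fun s h => ε s h ω) t) : ℝ)) P := fun t => by
    refine ⟨(hcm t).coe_nnreal_real.aestronglyMeasurable, ?_⟩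
    rw [hasFiniteIntegral_iff_ofReal (ae_of_all _ fun _ => NNReal.coe_nonneg _)]
    simp_rw [ENNReal.ofReal_coe_nnreal]
    exact (hsqrt t).trans_lt ENNReal.ofReal_lt_top
  have hsum : Integrable (fun ω => ∑ t ∈ Finset.range T, (LC3.cumCost (c t)
      (LC3.runTraj φ W x0 alg (fun s h => ε s h ω) t) : ℝ)) P :=
    integrable_finsetSum _ fun t _ => hint t
  refine ⟨hsum.sub (integrable_const _), ?_⟩
  have hval : ∀ t, ∫ ω, (LC3.cumCost (c t)
      (LC3.runTraj φ W x0 alg (fun s h => ε s h ω) t) : ℝ) ∂P =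
      (∫⁻ ω, (LC3.cumCost (c t)
        (LC3.runTraj φ W x0 alg (fun s h => ε s h ω) t) : ℝ≥0∞) ∂P).toReal := fun t => by
    rw [integral_eq_lintegral_of_nonneg_ae (ae_of_all _ fun _ => NNReal.coe_nonneg _)
      (hint t).aestronglyMeasurable]
    simp_rw [ENNReal.ofReal_coe_nnreal]
  have hreg : ∫ ω, LC3.regret φ σ W x0 c Pol alg (fun s h => ε s h ω) T ∂P =
      ∑ t ∈ Finset.range T, ((∫⁻ ω, (LC3.cumCost (c t)
        (LC3.runTraj φ W x0 alg (fun s h => ε s h ω) t) : ℝ≥0∞) ∂P).toReal -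
        (LC3.Jstar φ σ x0 (c t) W Pol).toReal) := by
    unfold LC3.regret
    rw [integral_sub hsum (integrable_const _), integral_finsetSum _ fun t _ => hint t,
      Finset.sum_sub_distrib]
    simp [hval]
  rw [hreg]
  rcases Nat.eq_zero_or_pos T with rfl | hT
  · simp
  -- For `H = 0` the bound is `0` and there are no costs; afterwards `1 ≤ H` is available to
  -- `regret_arith`.
  rcases Nat.eq_zero_or_pos H with rfl | hH
  · have h0 : ∀ t, (∫⁻ ω, (LC3.cumCost (c t)
        (LC3.runTraj φ W x0 alg (fun s h => ε s h ω) t) : ℝ≥0∞) ∂P) = 0 := fun t => by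
      simp [LC3.cumCost]
    simp_rw [h0]
    simp only [ENNReal.toReal_zero, zero_sub, Finset.sum_neg_distrib, CharP.cast_eq_zero, mul_zero,
      zero_mul, Real.sqrt_zero]
    exact neg_nonpos.2 (Finset.sum_nonneg fun _ _ => ENNReal.toReal_nonneg)
  have hdφ : 1 ≤ dφ := by
    rcases Nat.eq_zero_or_pos dφ with rfl | h
    · exact absurd (Subsingleton.elim _ _) hW
    · exact h
  -- The choice made by the algorithm shows that `Pol` is nonempty, so `J⋆` is finite and `toReal`
  -- does not replace it by the default value `0`.
  have hJ : ∀ t, LC3.Jstar φ σ x0 (c t) W Pol ≠ ∞ := fun t => by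
    obtain ⟨ω, hω⟩ := (hopt t).exists
    exact ne_top_of_le_ne_top ENNReal.ofReal_ne_top ((iInf₂_le _ hω.1).trans
      (LC3.J_le_sqrt hφ x0 (hc t) W (hPol _ hω.1) (hV t _ hω.1)))
  set D : ℕ → ℝ≥0∞ := fun t => ∫⁻ ω, ENNReal.ofReal (LC3.width φ lam σ (LC3.specNorm W)
        (LC3.runHist φ W x0 alg (fun s h => ε s h ω) t)
        (LC3.runTraj φ W x0 alg (fun s h => ε s h ω) t)) ∂P with hD
  have hDtop : ∀ t, D t ≠ ∞ := fun t => by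
    refine ne_top_of_le_ne_top ENNReal.one_ne_top ((lintegral_mono fun ω =>
      (ENNReal.ofReal_le_ofReal (min_le_right _ _)).trans_eq ENNReal.ofReal_one).trans ?_)
    simp
  set L := Real.log (1 + B ^ 2 * LC3.specNorm W ^ 2 / σ ^ 2 * (T * H / dφ)) with hL
  have hL0 : 0 ≤ L := Real.log_nonneg (le_add_of_nonneg_right (by positivity))
  have hldr : ∀ ω, LC3.logDetRatio φ lam (LC3.runHist φ W x0 alg (fun s h => ε s h ω) T) ≤
      dφ * L := fun ω => by
    refine (LC3.logDetRatio_le φ hlam0 hB _).trans_eq ?_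
    rw [hL, hlam]
    congr 4
    field_simp
  have hDsum : ∑ t ∈ (Finset.range T).erase 0, (D t).toReal ≤
      160 * (1 + dX + Real.log T + dφ * L) * (dφ * L) := by
    have hlT := Real.log_natCast_nonneg T
    rw [← ENNReal.toReal_sum fun t _ => hDtop t]
    refine ENNReal.toReal_le_of_le_ofReal (by positivity) ?_
    have hm : ∀ t, Measurable fun ω => ENNReal.ofReal (LC3.width φ lam σ (LC3.specNorm W)
        (LC3.runHist φ W x0 alg (fun s h => ε s h ω) t)
        (LC3.runTraj φ W x0 alg (fun s h => ε s h ω) t)) := fun t =>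
      ((LC3.measurable_width hφ lam σ (LC3.specNorm W)).comp
        ((LC3.measurable_runHist hφ W x0 halg t fun s _ h => hε s h).prodMk
        (LC3.measurable_runTraj hφ W x0 halg t fun s _ h => hε s h))).ennreal_ofReal
    simp only [hD]
    rw [← lintegral_finsetSum _ fun t _ => hm t]
    refine (lintegral_mono fun ω => ?_).trans_eq
      ((lintegral_const (ENNReal.ofReal (160 * (1 + dX + Real.log T + dφ * L) * (dφ * L)))).trans
        (by simp))
    rw [← ENNReal.ofReal_sum_of_nonneg]
    · exact ENNReal.ofReal_le_ofReal (LC3.sum_width_le φ hσ hlam0 hw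
        (LC3.runTraj φ W x0 alg (fun s h => ε s h ω)) (hldr ω))
    · intro t ht
      have ht0 := (Finset.mem_erase.1 ht).1
      refine le_min (mul_nonneg ?_ (LC3.trajQuad_nonneg φ hlam0 _ _)) zero_le_one
      rw [LC3.beta_eq φ hlam0 hw ht0]
      have := Real.log_natCast_nonneg t
      have := LC3.logDetRatio_nonneg φ hlam0
        (LC3.runHist φ W x0 alg (fun s h => ε s h ω) t)
      positivity
  refine LC3.regret_arith V.coe_nonneg (by exact_mod_cast hdφ) (Nat.cast_nonneg _)
    (Real.log_natCast_nonneg T) (by exact_mod_cast hH) (by exact_mod_cast hT) hL0 fun a ha => ?_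
  have hep : ∀ t ∈ (Finset.range T).erase 0, (∫⁻ ω, (LC3.cumCost (c t)
        (LC3.runTraj φ W x0 alg (fun s h => ε s h ω) t) : ℝ≥0∞) ∂P).toReal -
        (LC3.Jstar φ σ x0 (c t) W Pol).toReal ≤
      V / (2 * a) + a * (D t).toReal + √V * (1 / (4 * t)) := by
    intro t ht
    have h := LC3.lintegral_cumCost_le hφ hσ hlam0 hw x0 hPol (hc t) (hV t) halg hε hlaw hind
      (Finset.mem_erase.1 ht).1 (hopt t) ha
    have h2 := ENNReal.toReal_mono (by
      refine ENNReal.add_ne_top.2 ⟨ENNReal.add_ne_top.2 ⟨ENNReal.add_ne_top.2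
        ⟨hJ t, ENNReal.ofReal_ne_top⟩, ENNReal.mul_ne_top ENNReal.ofReal_ne_top (hDtop t)⟩,
        ENNReal.mul_ne_top ENNReal.ofReal_ne_top ENNReal.ofReal_ne_top⟩) h
    rw [ENNReal.toReal_add (ENNReal.add_ne_top.2 ⟨ENNReal.add_ne_top.2
        ⟨hJ t, ENNReal.ofReal_ne_top⟩, ENNReal.mul_ne_top ENNReal.ofReal_ne_top (hDtop t)⟩)
        (ENNReal.mul_ne_top ENNReal.ofReal_ne_top ENNReal.ofReal_ne_top),
      ENNReal.toReal_add (ENNReal.add_ne_top.2 ⟨hJ t, ENNReal.ofReal_ne_top⟩)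
        (ENNReal.mul_ne_top ENNReal.ofReal_ne_top (hDtop t)),
      ENNReal.toReal_add (hJ t) ENNReal.ofReal_ne_top, ENNReal.toReal_mul, ENNReal.toReal_mul,
      ENNReal.toReal_ofReal (by positivity), ENNReal.toReal_ofReal ha.le,
      ENNReal.toReal_ofReal (Real.sqrt_nonneg _), ENNReal.toReal_ofReal (by positivity)] at h2
    linarith
  -- Episode `0` is split off, since the width bound concerns the regression balls of `t ≥ 1`.
  rw [← Finset.add_sum_erase _ _ (Finset.mem_range.2 hT)]
  refine add_le_add ?_ ((Finset.sum_le_sum hep).trans ?_)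
  · have h1 := ENNReal.toReal_le_of_le_ofReal (Real.sqrt_nonneg _) (hsqrt 0)
    have h2 : 0 ≤ (LC3.Jstar φ σ x0 (c 0) W Pol).toReal := ENNReal.toReal_nonneg
    linarith
  · rw [Finset.sum_add_distrib, Finset.sum_add_distrib, ← Finset.mul_sum, ← Finset.mul_sum,
      Finset.sum_const, nsmul_eq_mul]
    refine add_le_add (add_le_add ?_ (mul_le_mul_of_nonneg_left hDsum ha.le))
      (mul_le_mul_of_nonneg_left (LC3.sum_inv_four_mul_le_sqrt T) (Real.sqrt_nonneg _))
    refine mul_le_mul_of_nonneg_right ?_ (by positivity)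
    exact_mod_cast (Finset.card_erase_le).trans_eq (Finset.card_range T)
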